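/- For an $n\times n$ real matrix $A$ with row sums $r_i(A)$ and column sums $c_j(A)$, write $r(A)=(r_1(A),\dots,r_n(A))$ and $c(A)=(c_1(A),\dots,c_n(A))$. The Sinkhorn–Knopp algorithm with input $A$ produces the matrices $A^{(0)},A^{(1)},\dots$ with $A^{(0)}_{i,j}=A_{i,j}/r_i(A)$ and, for $k>0$, $A^{(k)}_{i,j}=A^{(k-1)}_{i,j}/c_j(A^{(k-1)})$ if $k$ is odd and $A^{(k)}_{i,j}=A^{(k-1)}_{i,j}/r_i(A^{(k-1)})$ if $k$ is even. It converges on $A$ if $A^{(k)}$ tends to a doubly stochastic matrix. A nonnegative matrix $A$ is $(\mathbf 1,\mathbf 1)$-scalable if there are diagonal matrices $X,Y$ with positive diagonals such that all row and column sums of $XAY$ are $1$. A matrix with entries in $[0,1]$ is $(\gamma,\rho)$-dense if some row or column contains exactly $\lceil\gamma n\rceil$ entries that are at least $\rho$ and every row and every column contains at least $\lceil\gamma n\rceil$ such entries. For an even integer $n>10000$, $\gamma\in(1/4,1/2)$ with $n-2\lceil\gamma n\rceil\ge 2$, and $\varepsilon>0$, let $\beta=\varepsilon^8/(100n^{61})$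 and let $A=A_{n,\gamma,\varepsilon}$ be the $n\times n$ matrix with - $A_{i,j}=1$ if $i,j\le n/2-1$ and $(j-i)\bmod(n/2-1)<\lceil\gamma n\rceil$; or $i,j>n/2+1$ and $(j-i)\bmod(n/2-1)<\lceil\gamma n\rceil$; or $n/2\le i\le n/2+1$ and $j>n/2+1$; or $i=j=n/2$; or $i=j=n/2+1$ (residues are taken in $\{0,\dots,n/2-2\}$); - $A_{i,j}=2\lceil\gamma n\rceil/n$ if $i\le n/2-1$ and $n/2\le j\le n/2+1$; - $A_{i,j}=\beta$ otherwise. **Theorem 1.3.** There are absolute constants $c>0$ and $\rho\in(0,1]$ such that the following holds for every even integer $n>10000$. There exists $\gamma\in(1/4,1/2)$ with $n-2\lceil\gamma n\rceil\ge2$; and for every such $\gamma$ and every $0<\varepsilon<10^{-3}$, the matrix $A=A_{n,\gamma,\varepsilon}$ is positive, has all entries in $[\varepsilon^8/(100n^{61}),1]$, is $(\gamma,\rho)$-dense and $(\mathbf 1,\mathbf 1)$-scalable, the Sinkhorn–Knopp algorithm converges on $A$, and $$\|r(A^{(k)})-\mathbf 1\|_1+\|c(A^{(k)})-\mathbf 1\|_1>\varepsilon\quad\text{for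 every integer } 0\le k\le c\,n/\varepsilon .$$ If moreover $\varepsilon\le 1/(1000\sqrt n)$, then $$\|r(A^{(k)})-\mathbf 1\|_2+\|c(A^{(k)})-\mathbf 1\|_2>\varepsilon\quad\text{for every integer } 0\le k\le c\,\sqrt n/\varepsilon .$$ That is, the algorithm needs $\Omega(n/\varepsilon)$ iterations to reach $\ell_1$ error at most $\varepsilon$ and, for $\varepsilon\le1/(1000\sqrt n)$, $\Omega(\sqrt n/\varepsilon)$ iterations to reach $\ell_2$ error at most $\varepsilon$. -/

import Mathlib

open Filter Topology
open scoped ENNReal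

namespace SinkhornLB

noncomputable section

/-- `r(A)`: the vector of row sums. -/
def rowSum {m n : ℕ} (A : Matrix (Fin m) (Fin n) ℝ) : Fin m → ℝ := fun i => ∑ k, A i k

/-- `c(A)`: the vector of column sums. -/
def colSum {m n : ℕ} (A : Matrix (Fin m) (Fin n) ℝ) : Fin n → ℝ := fun j => ∑ k, A k j

/-- Divide every row by its sum. -/
def rowNormalize {m n : ℕ} (A : Matrix (Fin m) (Fin n) ℝ) : Matrix (Fin m) (Fin n) ℝ :=
  Matrix.of fun i j => A i j / rowSum A i

/-- Divide every column by its sum. -/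
def colNormalize {m n : ℕ} (A : Matrix (Fin m) (Fin n) ℝ) : Matrix (Fin m) (Fin n) ℝ :=
  Matrix.of fun i j => A i j / colSum A j

/-- The sequence `A⁽⁰⁾, A⁽¹⁾, …` generated by the Sinkhorn–Knopp algorithm for
`(1,1)`-scaling: `A⁽⁰⁾` is the row normalization of `A`; for `k > 0`, `A⁽ᵏ⁾` is the column
normalization of `A⁽ᵏ⁻¹⁾` when `k` is odd and its row normalization when `k` is even. -/
def sinkhornKnopp {n : ℕ} (A : Matrix (Fin n) (Fin n) ℝ) : ℕ → Matrix (Fin n) (Fin n) ℝ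
  | 0 => rowNormalize A
  | k + 1 =>
    if Odd (k + 1) then colNormalize (sinkhornKnopp A k) else rowNormalize (sinkhornKnopp A k)

/-- The Sinkhorn–Knopp algorithm converges on `A`: its iterates tend to a doubly stochastic
matrix. -/
def SinkhornKnoppConverges {n : ℕ} (A : Matrix (Fin n) (Fin n) ℝ) : Prop :=
  ∃ L ∈ doublyStochastic ℝ (Fin n), Tendsto (sinkhornKnopp A) atTop (𝓝 L)

/-- The `ℓ_p` error `‖r(A) - 1‖_p + ‖c(A) - 1‖_p`. -/
def scalingError {n : ℕ} (p : ℝ≥0∞) (A : Matrix (Fin n) (Fin n) ℝ) : ℝ :=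
  ‖WithLp.toLp p (rowSum A - 1)‖ + ‖WithLp.toLp p (colSum A - 1)‖

/-- A nonnegative matrix `A` is `(r,c)`-scalable: there are diagonal matrices `X`, `Y` with
strictly positive diagonals such that `X A Y` has row sums `r` and column sums `c`. -/
def IsScalable {m n : ℕ} (A : Matrix (Fin m) (Fin n) ℝ) (r : Fin m → ℝ) (c : Fin n → ℝ) : Prop :=
  (∀ i j, 0 ≤ A i j) ∧
    ∃ (x : Fin m → ℝ) (y : Fin n → ℝ), (∀ i, 0 < x i) ∧ (∀ j, 0 < y j) ∧
      rowSum (Matrix.diagonal x * A * Matrix.diagonal y) = r ∧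
      colSum (Matrix.diagonal x * A * Matrix.diagonal y) = c

/-- The number of entries of row `i` that are at least `ρ`. -/
def rowCount {n : ℕ} (ρ : ℝ) (A : Matrix (Fin n) (Fin n) ℝ) (i : Fin n) : ℕ :=
  {j : Fin n | ρ ≤ A i j}.ncard

/-- The number of entries of column `j` that are at least `ρ`. -/
def colCount {n : ℕ} (ρ : ℝ) (A : Matrix (Fin n) (Fin n) ℝ) (j : Fin n) : ℕ :=
  {i : Fin n | ρ ≤ A i j}.ncard

/-- An `n × n` matrix with entries in `[0,1]` is `(γ,ρ)`-dense: some row or column has exactly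
`⌈γ n⌉` entries that are at least `ρ`, and all rows and columns have at least that many. -/
def IsDenseMatrix {n : ℕ} (γ ρ : ℝ) (A : Matrix (Fin n) (Fin n) ℝ) : Prop :=
  (∀ i j, A i j ∈ Set.Icc (0 : ℝ) 1) ∧
    ((∃ i, rowCount ρ A i = ⌈γ * n⌉₊) ∨ (∃ j, colCount ρ A j = ⌈γ * n⌉₊)) ∧
    (∀ i, ⌈γ * n⌉₊ ≤ rowCount ρ A i) ∧ (∀ j, ⌈γ * n⌉₊ ≤ colCount ρ A j)

/-- The positions, in 1-based indices `(i, j)`, of the entries `1`; here `g = ⌈γ n⌉`. -/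
def IsOnePos (n g i j : ℕ) : Prop :=
  (i ≤ n / 2 - 1 ∧ j ≤ n / 2 - 1 ∧ ((j : ℤ) - (i : ℤ)) % ((n / 2 - 1 : ℕ) : ℤ) < (g : ℤ)) ∨
  (n / 2 + 1 < i ∧ n / 2 + 1 < j ∧
    ((j : ℤ) - (i : ℤ)) % ((n / 2 - 1 : ℕ) : ℤ) < (g : ℤ)) ∨
  (n / 2 ≤ i ∧ i ≤ n / 2 + 1 ∧ n / 2 + 1 < j) ∨
  (i = n / 2 ∧ j = n / 2) ∨
  (i = n / 2 + 1 ∧ j = n / 2 + 1)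

/-- The positions, in 1-based indices `(i, j)`, of the entries `2 ⌈γ n⌉ / n`. -/
def IsMidPos (n i j : ℕ) : Prop :=
  i ≤ n / 2 - 1 ∧ n / 2 ≤ j ∧ j ≤ n / 2 + 1

open Classical in
/-- The explicit `n × n` matrix (`n` even); the entry of `Fin`-index `(i, j)` has 1-based index
`(i + 1, j + 1)`, and all entries outside the two position sets are `ε ^ 8 / (100 n ^ 61)`. -/
def slowMatrix (n : ℕ) (γ ε : ℝ) : Matrix (Fin n) (Fin n) ℝ :=
  Matrix.of fun i j =>
    if IsOnePos n ⌈γ * n⌉₊ (i.val + 1) (j.val + 1) then 1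
    else if IsMidPos n (i.val + 1) (j.val + 1) then 2 * (⌈γ * n⌉₊ : ℝ) / n
    else ε ^ 8 / (100 * (n : ℝ) ^ 61)

end

end SinkhornLB

/-!
The matrix has blocks of sizes `h, 2, h` with `h = n / 2 - 1`. Without the tiny entries `β`, the first columns
meet only the first rows and the last rows meet only the last columns, so that the mass in the two
blocks linking them to the middle (first rows and middle columns, middle rows and last columns)
would have to disappear in a doubly stochastic limit; but it decreases only like `h / k`, and the
entries `β` are too small to change this in the stated number of steps.

By symmetry the row and column factors are constant on the three blocks (`sum_blockEntry_mul`,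
`sum_mul_blockEntry`), so one normalization is a map on triples. Let `z k` be the ratio of the
linking mass to the diagonal mass in a middle row or column before step `k`. For `β = 0` it satisfies
`z (k + 1) = z (k - 1) * (1 + z k) / (1 + (1 + 2 / h) * z (k - 1))`, which is monotone in both
arguments, and `1 / (v₀ + 2 * k / h)` is a subsolution. `SlowInv.step` is this comparison in a first
order form that also absorbs the entries `β`: it gives `z k ≥ 1 / v` with `v = 2 + 2 * k / h`. By
`SlowInv.excess` the linking mass then makes `h` of the row or column sums exceed `1` by at least
`1 / (2 * h * v)` each. This is an `ℓ₁` error of `1 / (2 * v)` and an `ℓ₂` error of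
`1 / (2 * √h * v)`, and `v` stays below `1 / (2 * ε)`, respectively `1 / (2 * √n * ε)`, for the stated
number of steps. All entries `β` are negligible at such levels.

Scalability and convergence hold for all positive square matrices (`isScalable_and_converges`): the
inverse column sums after a row normalization are averaged twice between consecutive rounds, with
weights bounded below because scaling preserves cross ratios, so their range contracts geometrically
and the logarithms of the factors converge.
-/

namespace SinkhornLB

noncomputable section

section

/-! ### Convergence for positive matrices -/

/-- The row factors `x` for which `diag x * A * diag y` has unit row sums. -/
def rowFactor {n : ℕ} (A : Matrix (Fin n) (Fin n) ℝ) (y : Fin n → ℝ) : Fin n → ℝ :=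
  fun i => (∑ j, A i j * y j)⁻¹

/-- The column factors `y` for which `diag x * A * diag y` has unit column sums. -/
def colFactor {n : ℕ} (A : Matrix (Fin n) (Fin n) ℝ) (x : Fin n → ℝ) : Fin n → ℝ :=
  fun j => (∑ i, x i * A i j)⁻¹

/-- The accumulated column factors of the Sinkhorn–Knopp algorithm after `t` column
normalizations. -/
def colScale {n : ℕ} (A : Matrix (Fin n) (Fin n) ℝ) : ℕ → Fin n → ℝ
  | 0 => fun _ => 1
  | t + 1 => colFactor A (rowFactor A (colScale A t))

/-- The accumulated row factors of the Sinkhorn–Knopp algorithm after `t + 1` row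
normalizations. -/
def rowScale {n : ℕ} (A : Matrix (Fin n) (Fin n) ℝ) (t : ℕ) : Fin n → ℝ :=
  rowFactor A (colScale A t)

/-- The matrix `diag x * A * diag y`. -/
def scaled {n : ℕ} (A : Matrix (Fin n) (Fin n) ℝ) (x y : Fin n → ℝ) : Matrix (Fin n) (Fin n) ℝ :=
  Matrix.of fun i j => x i * A i j * y j

variable {n : ℕ} {A : Matrix (Fin n) (Fin n) ℝ}

theorem diagonal_mul_mul_diagonal_eq_scaled (x y : Fin n → ℝ) :
    Matrix.diagonal x * A * Matrix.diagonal y = scaled A x y := by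
  ext i j
  simp [scaled, Matrix.mul_diagonal, Matrix.diagonal_mul]

theorem rowFactor_pos (hA : ∀ i j, 0 < A i j) {y : Fin n → ℝ} (hy : ∀ j, 0 < y j) (i : Fin n) :
    0 < rowFactor A y i :=
  inv_pos.2 (Finset.sum_pos (fun j _ => mul_pos (hA i j) (hy j)) ⟨i, Finset.mem_univ i⟩)

theorem colFactor_pos (hA : ∀ i j, 0 < A i j) {x : Fin n → ℝ} (hx : ∀ i, 0 < x i) (j : Fin n) :
    0 < colFactor A x j :=
  inv_pos.2 (Finset.sum_pos (fun i _ => mul_pos (hx i) (hA i j)) ⟨j, Finset.mem_univ j⟩)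

theorem colScale_pos (hA : ∀ i j, 0 < A i j) (t : ℕ) : ∀ j, 0 < colScale A t j := by
  induction t with
  | zero => intro j; simp [colScale]
  | succ t ih => exact colFactor_pos hA (rowFactor_pos hA ih)

theorem rowScale_pos (hA : ∀ i j, 0 < A i j) (t : ℕ) (i : Fin n) : 0 < rowScale A t i :=
  rowFactor_pos hA (colScale_pos hA t) i

theorem rowSum_scaled (x y : Fin n → ℝ) (i : Fin n) :
    rowSum (scaled A x y) i = x i * ∑ j, A i j * y j := by
  simp [rowSum, scaled, Finset.mul_sum, mul_assoc]

theorem colSum_scaled (x y : Fin n → ℝ) (j : Fin n) :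
    colSum (scaled A x y) j = (∑ i, x i * A i j) * y j := by
  simp [colSum, scaled, Finset.sum_mul]

theorem rowSum_scaled_rowFactor (hA : ∀ i j, 0 < A i j) {y : Fin n → ℝ} (hy : ∀ j, 0 < y j)
    (i : Fin n) : rowSum (scaled A (rowFactor A y) y) i = 1 := by
  rw [rowSum_scaled]
  exact inv_mul_cancel₀ (inv_pos.1 (rowFactor_pos hA hy i)).ne'

theorem colSum_scaled_colFactor (hA : ∀ i j, 0 < A i j) {x : Fin n → ℝ} (hx : ∀ i, 0 < x i)
    (j : Fin n) : colSum (scaled A x (colFactor A x)) j = 1 := by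
  rw [colSum_scaled]
  exact mul_inv_cancel₀ (inv_pos.1 (colFactor_pos hA hx j)).ne'

theorem rowNormalize_scaled {x : Fin n → ℝ} (hx : ∀ i, 0 < x i) (y : Fin n → ℝ) :
    rowNormalize (scaled A x y) = scaled A (rowFactor A y) y := by
  ext i j
  simp only [rowNormalize, Matrix.of_apply, rowSum_scaled]
  simp only [scaled, rowFactor, Matrix.of_apply]
  rw [mul_assoc, mul_div_mul_left _ _ (hx i).ne', div_eq_inv_mul, mul_assoc]

theorem colNormalize_scaled {y : Fin n → ℝ} (hy : ∀ j, 0 < y j) (x : Fin n → ℝ) :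
    colNormalize (scaled A x y) = scaled A x (colFactor A x) := by
  ext i j
  simp only [colNormalize, Matrix.of_apply, colSum_scaled]
  simp only [scaled, colFactor, Matrix.of_apply]
  rw [mul_div_mul_right _ _ (hy j).ne', div_eq_mul_inv]

theorem sinkhornKnopp_even_odd (hA : ∀ i j, 0 < A i j) (t : ℕ) :
    sinkhornKnopp A (2 * t) = scaled A (rowScale A t) (colScale A t) ∧
    sinkhornKnopp A (2 * t + 1) = scaled A (rowScale A t) (colScale A (t + 1)) := by
  have odd_of_even : ∀ t, sinkhornKnopp A (2 * t) = scaled A (rowScale A t) (colScale A t) →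
      sinkhornKnopp A (2 * t + 1) = scaled A (rowScale A t) (colScale A (t + 1)) := by
    intro t ht
    have ho : Odd (2 * t + 1) := ⟨t, rfl⟩
    rw [sinkhornKnopp, if_pos ho, ht, colNormalize_scaled (colScale_pos hA t)]
    rfl
  induction t with
  | zero =>
    have h0 : sinkhornKnopp A (2 * 0) = scaled A (rowScale A 0) (colScale A 0) := by
      have h1 : A = scaled A (fun _ => 1) (fun _ => 1) := by ext i j; simp [scaled]
      calc sinkhornKnopp A (2 * 0) = rowNormalize (scaled A (fun _ => 1) (fun _ => 1)) := by
            rw [← h1]; rfl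
        _ = _ := by rw [rowNormalize_scaled (fun _ => one_pos)]; rfl
    exact ⟨h0, odd_of_even 0 h0⟩
  | succ t ih =>
    have h1 : sinkhornKnopp A (2 * (t + 1)) =
        scaled A (rowScale A (t + 1)) (colScale A (t + 1)) := by
      have ho : ¬ Odd (2 * t + 1 + 1) := by
        rw [Nat.not_odd_iff_even]; exact ⟨t + 1, by ring⟩
      have h2 : 2 * (t + 1) = 2 * t + 1 + 1 := by ring
      rw [h2, sinkhornKnopp, if_neg ho, ih.2, rowNormalize_scaled (rowScale_pos hA t)]
      rfl
    exact ⟨h1, odd_of_even _ h1⟩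

/-- A weighted average of numbers in `[a, b]`, all weights being at least `κ`, stays `κ * (b - a)`
below `b` once the value `a` is attained. -/
theorem sum_mul_le_of_attained {ι : Type*} [Fintype ι] {w u : ι → ℝ} {κ a b : ℝ}
    (hw : ∀ i, κ ≤ w i) (hκ : 0 ≤ κ) (hsum : ∑ i, w i = 1) (hb : ∀ i, u i ≤ b)
    {i₀ : ι} (ha : u i₀ = a) : ∑ i, w i * u i ≤ b - κ * (b - a) := by
  have h1 : w i₀ * (b - u i₀) ≤ ∑ i, w i * (b - u i) :=
    Finset.single_le_sum (f := fun i => w i * (b - u i))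
      (fun i _ => mul_nonneg (hκ.trans (hw i)) (sub_nonneg.2 (hb i))) (Finset.mem_univ i₀)
  have h2 : ∑ i, w i * (b - u i) = b - ∑ i, w i * u i := by
    simp only [mul_sub, Finset.sum_sub_distrib, ← Finset.sum_mul, hsum, one_mul]
  have h3 : κ * (b - u i₀) ≤ w i₀ * (b - u i₀) :=
    mul_le_mul_of_nonneg_right (hw i₀) (sub_nonneg.2 (hb i₀))
  rw [ha] at h1 h3
  linarith

theorem le_sum_mul {ι : Type*} [Fintype ι] {w u : ι → ℝ} {a : ℝ}
    (hw : ∀ i, 0 ≤ w i) (hsum : ∑ i, w i = 1) (ha : ∀ i, a ≤ u i) : a ≤ ∑ i, w i * u i := by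
  calc a = ∑ i, w i * a := by rw [← Finset.sum_mul, hsum, one_mul]
    _ ≤ _ := Finset.sum_le_sum fun i _ => mul_le_mul_of_nonneg_left (ha i) (hw i)

/-- Bounds on the column sums of a row-stochastic matrix bound its entries from below, because the
cross ratios `P i j * P k l / (P i l * P k j)` are those of `A`. -/
theorem entry_lower_bound {x y : Fin n → ℝ} {a lo : ℝ} (ha : 0 < a)
    (hA : ∀ i j, A i j ∈ Set.Icc a 1) (hx : ∀ i, 0 < x i) (hy : ∀ j, 0 < y j)
    (hrow : ∀ i, rowSum (scaled A x y) i = 1) (hcol : ∀ j, lo ≤ colSum (scaled A x y) j)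
    (i j : Fin n) : a ^ 2 * lo / n ^ 2 ≤ scaled A x y i j := by
  have hpos : ∀ i j, 0 < scaled A x y i j := fun i j =>
    mul_pos (mul_pos (hx i) (ha.trans_le (hA i j).1)) (hy j)
  have hn : (0 : ℝ) < n := by exact_mod_cast i.pos
  obtain ⟨k, -, hk⟩ : ∃ k ∈ Finset.univ, lo / n ≤ scaled A x y k j := by
    apply Finset.exists_le_of_sum_le ⟨i, Finset.mem_univ i⟩
    have := hcol j
    simp only [Finset.sum_const, Finset.card_univ, Fintype.card_fin, nsmul_eq_mul]
    rwa [mul_div_cancel₀ _ hn.ne']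
  have hcross : ∀ l, a ^ 2 * (lo / n) * scaled A x y i l ≤ scaled A x y i j := by
    intro l
    have hle : scaled A x y k l ≤ 1 := by
      rw [← hrow k]
      exact Finset.single_le_sum (f := fun l => scaled A x y k l) (fun l _ => (hpos k l).le)
        (Finset.mem_univ l)
    have h1 : a ^ 2 * (scaled A x y k j * scaled A x y i l) ≤
        scaled A x y i j * scaled A x y k l := by
      have e1 : scaled A x y k j * scaled A x y i l =
        (A k j * A i l) * (x k * y j * x i * y l) := by simp only [scaled, Matrix.of_apply]; ring
      have e2 : scaled A x y i j * scaled A x y k l =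
        (A i j * A k l) * (x k * y j * x i * y l) := by simp only [scaled, Matrix.of_apply]; ring
      have hz : 0 < x k * y j * x i * y l :=
        mul_pos (mul_pos (mul_pos (hx k) (hy j)) (hx i)) (hy l)
      rw [e1, e2, ← mul_assoc]
      refine mul_le_mul_of_nonneg_right ?_ hz.le
      have h2 : A k j * A i l ≤ 1 :=
        mul_le_one₀ (hA k j).2 (ha.le.trans (hA i l).1) (hA i l).2
      have h3 : a * a ≤ A i j * A k l :=
        mul_le_mul (hA i j).1 (hA k l).1 ha.le (ha.le.trans (hA i j).1)
      nlinarith [sq_nonneg a]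
    calc a ^ 2 * (lo / n) * scaled A x y i l
        = a ^ 2 * (lo / n * scaled A x y i l) := by ring
      _ ≤ a ^ 2 * (scaled A x y k j * scaled A x y i l) := by
          have := (hpos i l).le
          gcongr
      _ ≤ scaled A x y i j * scaled A x y k l := h1
      _ ≤ scaled A x y i j * 1 := by
          have := (hpos i j).le
          gcongr
      _ = _ := mul_one _
  have hsum := Finset.sum_le_sum fun l (_ : l ∈ Finset.univ) => hcross l
  rw [← Finset.mul_sum] at hsum
  have hr : ∑ l, scaled A x y i l = 1 := hrow i
  rw [hr] at hsum
  simp only [Finset.sum_const, Finset.card_univ, Fintype.card_fin, nsmul_eq_mul, mul_one] at hsum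
  rw [div_le_iff₀ (by positivity)]
  have e : a ^ 2 * lo = a ^ 2 * (lo / n) * n := by field_simp
  rw [e]
  nlinarith

theorem colSum_eq_div (t : ℕ) (j : Fin n) :
    colSum (scaled A (rowScale A t) (colScale A t)) j = colScale A t j / colScale A (t + 1) j := by
  rw [colSum_scaled]
  change _ = _ / (∑ i, rowScale A t i * A i j)⁻¹
  rw [div_inv_eq_mul, mul_comm]

/-- The ratios `x (t) / x (t + 1)` of row factors are averages, over the rows of the current
row-stochastic matrix, of the inverse column sums. -/
theorem rowScale_div_eq_sum (hA : ∀ i j, 0 < A i j) (t : ℕ) (i : Fin n) :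
    rowScale A t i / rowScale A (t + 1) i =
      ∑ j, scaled A (rowScale A t) (colScale A t) i j *
        (colScale A (t + 1) j / colScale A t j) := by
  change _ / (∑ j, A i j * colScale A (t + 1) j)⁻¹ = _
  rw [div_inv_eq_mul, Finset.mul_sum]
  refine Finset.sum_congr rfl fun j _ => ?_
  have := (colScale_pos hA t j).ne'
  simp only [scaled, Matrix.of_apply]
  field_simp

theorem colScale_div_eq_sum (hA : ∀ i j, 0 < A i j) (t : ℕ) (j : Fin n) :
    colScale A (t + 1) j / colScale A (t + 2) j =
      ∑ i, scaled A (rowScale A t) (colScale A (t + 1)) i j *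
        (rowScale A (t + 1) i / rowScale A t i) := by
  change _ / (∑ i, rowScale A (t + 1) i * A i j)⁻¹ = _
  rw [div_inv_eq_mul, Finset.mul_sum]
  refine Finset.sum_congr rfl fun i _ => ?_
  have := (rowScale_pos hA t i).ne'
  simp only [scaled, Matrix.of_apply]
  field_simp

end

section

variable {n : ℕ} {A : Matrix (Fin n) (Fin n) ℝ}

/-- One round contracts the range of the inverse column sums `y (t + 1) / y t`: the weights
averaging them into `x t / x (t + 1)` are the entries of the current matrix, all at least `κ`. -/
theorem colScale_ratio_contract (hA : ∀ i j, 0 < A i j) {t : ℕ} {κ a b : ℝ} (ha : 0 < a)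
    (hκ : 0 ≤ κ) (hP : ∀ i j, κ ≤ scaled A (rowScale A t) (colScale A t) i j)
    (hlo : ∀ j, a ≤ colScale A (t + 1) j / colScale A t j)
    (hhi : ∀ j, colScale A (t + 1) j / colScale A t j ≤ b)
    {j₀ : Fin n} (hj₀ : colScale A (t + 1) j₀ / colScale A t j₀ = a) (j : Fin n) :
    a ≤ colScale A (t + 2) j / colScale A (t + 1) j ∧
      colScale A (t + 2) j / colScale A (t + 1) j ≤ b - κ * (b - a) := by
  have hPsum : ∀ i, ∑ j, scaled A (rowScale A t) (colScale A t) i j = 1 := fun i =>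
    rowSum_scaled_rowFactor hA (colScale_pos hA t) i
  have hQsum : ∑ i, scaled A (rowScale A t) (colScale A (t + 1)) i j = 1 :=
    colSum_scaled_colFactor hA (rowScale_pos hA t) j
  have hP0 : ∀ i j, 0 ≤ scaled A (rowScale A t) (colScale A t) i j := fun i j =>
    (mul_pos (mul_pos (rowScale_pos hA t i) (hA i j)) (colScale_pos hA t j)).le
  have hQ0 : ∀ i, 0 ≤ scaled A (rowScale A t) (colScale A (t + 1)) i j := fun i =>
    (mul_pos (mul_pos (rowScale_pos hA t i) (hA i j)) (colScale_pos hA (t + 1) j)).le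
  have hr_lo : ∀ i, a ≤ rowScale A t i / rowScale A (t + 1) i := fun i => by
    rw [rowScale_div_eq_sum hA]
    exact le_sum_mul (hP0 i) (hPsum i) hlo
  have hr_hi : ∀ i, rowScale A t i / rowScale A (t + 1) i ≤ b - κ * (b - a) := fun i => by
    rw [rowScale_div_eq_sum hA]
    exact sum_mul_le_of_attained (hP i) hκ (hPsum i) hhi hj₀
  have hr_pos : ∀ i, 0 < rowScale A t i / rowScale A (t + 1) i := fun i => ha.trans_le (hr_lo i)
  have hb : 0 < b - κ * (b - a) := (hr_pos j).trans_le (hr_hi j)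
  have hinv_hi : colScale A (t + 1) j / colScale A (t + 2) j ≤ a⁻¹ := by
    rw [colScale_div_eq_sum hA]
    have := sum_mul_le_of_attained (κ := 0) (u := fun i => rowScale A (t + 1) i / rowScale A t i)
      (b := a⁻¹) hQ0 le_rfl hQsum (fun i => by
        rw [← inv_div]; exact inv_anti₀ ha (hr_lo i)) (i₀ := j) rfl
    linarith
  have hinv_lo : (b - κ * (b - a))⁻¹ ≤ colScale A (t + 1) j / colScale A (t + 2) j := by
    rw [colScale_div_eq_sum hA]
    exact le_sum_mul hQ0 hQsum fun i => by
      rw [← inv_div (rowScale A t i)]; exact inv_anti₀ (hr_pos i) (hr_hi i)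
  have hpos : 0 < colScale A (t + 1) j / colScale A (t + 2) j :=
    div_pos (colScale_pos hA _ j) (colScale_pos hA _ j)
  rw [← inv_div (colScale A (t + 1) j)]
  exact ⟨le_inv_of_le_inv₀ hpos hinv_hi, inv_le_of_inv_le₀ hb hinv_lo⟩

/-- The ranges of `y (t + 1) / y t` are nested and shrink geometrically. -/
theorem exists_colScale_ratio_bounds [NeZero n] {α : ℝ} (hα : 0 < α)
    (hA : ∀ i j, A i j ∈ Set.Icc α 1) :
    ∃ a₀ > 0, ∃ D : ℝ, ∃ θ : ℝ, θ < 1 ∧ ∀ t, ∃ a b, a₀ ≤ a ∧ b - a ≤ D * θ ^ t ∧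
      ∀ j, a ≤ colScale A (t + 1) j / colScale A t j ∧
        colScale A (t + 1) j / colScale A t j ≤ b := by
  have hA0 : ∀ i j, 0 < A i j := fun i j => hα.trans_le (hA i j).1
  set u : ℕ → Fin n → ℝ := fun t j => colScale A (t + 1) j / colScale A t j with hu
  have hupos : ∀ t j, 0 < u t j := fun t j =>
    div_pos (colScale_pos hA0 _ j) (colScale_pos hA0 _ j)
  obtain ⟨jm, hjm⟩ := Finite.exists_min (u 0)
  obtain ⟨jM, hjM⟩ := Finite.exists_max (u 0)
  set a₀ := u 0 jm
  set b₀ := u 0 jM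
  have ha₀ : 0 < a₀ := hupos 0 jm
  have hb₀ : 0 < b₀ := hupos 0 jM
  have hn : (0 : ℝ) < n := by exact_mod_cast Nat.pos_of_neZero n
  set κ : ℝ := α ^ 2 * b₀⁻¹ / n ^ 2 with hκdef
  have hκ : 0 < κ := by positivity
  have hentry : ∀ t, (∀ j, u t j ≤ b₀) →
      ∀ i j, κ ≤ scaled A (rowScale A t) (colScale A t) i j := by
    intro t ht i j
    refine entry_lower_bound hα hA (rowScale_pos hA0 t) (colScale_pos hA0 t)
      (rowSum_scaled_rowFactor hA0 (colScale_pos hA0 t)) (fun j => ?_) i j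
    rw [colSum_eq_div, ← inv_div]
    exact inv_anti₀ (hupos t j) (ht j)
  have hκ1 : κ ≤ 1 := by
    refine (hentry 0 hjM jm jm).trans ?_
    rw [← rowSum_scaled_rowFactor hA0 (colScale_pos hA0 0) jm]
    exact Finset.single_le_sum (f := fun l => scaled A (rowScale A 0) (colScale A 0) jm l)
      (fun l _ => (mul_pos (mul_pos (rowScale_pos hA0 0 jm) (hA0 jm l))
        (colScale_pos hA0 0 l)).le) (Finset.mem_univ jm)
  refine ⟨a₀, ha₀, b₀ - a₀, 1 - κ, by linarith, ?_⟩
  have key : ∀ t, ∃ a b, a₀ ≤ a ∧ b ≤ b₀ ∧ b - a ≤ (b₀ - a₀) * (1 - κ) ^ t ∧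
      ∀ j, a ≤ u t j ∧ u t j ≤ b := by
    intro t
    induction t with
    | zero => exact ⟨a₀, b₀, le_rfl, le_rfl, by simp, fun j => ⟨hjm j, hjM j⟩⟩
    | succ t ih =>
      obtain ⟨a, b, ha, hb, hab, hj⟩ := ih
      obtain ⟨j₀, hj₀⟩ := Finite.exists_min (u t)
      have hc : ∀ j, u t j₀ ≤ u (t + 1) j ∧ u (t + 1) j ≤ b - κ * (b - u t j₀) :=
        colScale_ratio_contract hA0 (hupos t j₀) hκ.le
          (hentry t fun j => (hj j).2.trans hb) hj₀ (fun j => (hj j).2) rfl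
      have h1 : u t j₀ ≤ b := (hj j₀).2
      refine ⟨u t j₀, b - κ * (b - u t j₀), ha.trans (hj j₀).1, ?_, ?_, hc⟩
      · nlinarith
      · calc b - κ * (b - u t j₀) - u t j₀ = (b - u t j₀) * (1 - κ) := by ring
          _ ≤ (b - a) * (1 - κ) := by
            have := (hj j₀).1
            exact mul_le_mul_of_nonneg_right (by linarith) (by linarith)
          _ ≤ (b₀ - a₀) * (1 - κ) ^ t * (1 - κ) :=
            mul_le_mul_of_nonneg_right hab (by linarith)
          _ = _ := by ring
  intro t
  obtain ⟨a, b, ha, -, hab, hj⟩ := key t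
  exact ⟨a, b, ha, hab, hj⟩

/-- The column sums of a row-stochastic matrix average to `1`, so `1` lies between the bounds. -/
theorem colScale_ratio_bounds_one [NeZero n] (hA : ∀ i j, 0 < A i j) {t : ℕ} {a b : ℝ}
    (ha : 0 < a) (hab : ∀ j, a ≤ colScale A (t + 1) j / colScale A t j ∧
      colScale A (t + 1) j / colScale A t j ≤ b) : a ≤ 1 ∧ 1 ≤ b := by
  have hsum : ∑ j, colScale A t j / colScale A (t + 1) j = n := by
    calc ∑ j, colScale A t j / colScale A (t + 1) j
        = ∑ j, ∑ i, scaled A (rowScale A t) (colScale A t) i j :=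
          Finset.sum_congr rfl fun j _ => (colSum_eq_div t j).symm
      _ = ∑ i, ∑ j, scaled A (rowScale A t) (colScale A t) i j := Finset.sum_comm
      _ = ∑ i : Fin n, (1 : ℝ) :=
          Finset.sum_congr rfl fun i _ => rowSum_scaled_rowFactor hA (colScale_pos hA t) i
      _ = n := by simp
  have hn : (0 : ℝ) < n := by exact_mod_cast Nat.pos_of_neZero n
  have hb : 0 < b := ha.trans_le ((hab 0).1.trans (hab 0).2)
  have hpos : ∀ j, 0 < colScale A (t + 1) j / colScale A t j := fun j =>
    ha.trans_le (hab j).1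
  have h1 : (n : ℝ) ≤ n * a⁻¹ := by
    calc (n : ℝ) = ∑ j, colScale A t j / colScale A (t + 1) j := hsum.symm
      _ ≤ ∑ j : Fin n, a⁻¹ := Finset.sum_le_sum fun j _ => by
          rw [← inv_div]; exact inv_anti₀ ha (hab j).1
      _ = n * a⁻¹ := by simp
  have h2 : n * b⁻¹ ≤ (n : ℝ) := by
    calc n * b⁻¹ = ∑ j : Fin n, b⁻¹ := by simp
      _ ≤ ∑ j, colScale A t j / colScale A (t + 1) j := Finset.sum_le_sum fun j _ => by
          rw [← inv_div]; exact inv_anti₀ (hpos j) (hab j).2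
      _ = n := hsum
  constructor
  · rw [← div_eq_mul_inv, le_div_iff₀ ha] at h1
    exact le_of_mul_le_mul_left (by linarith) hn
  · rw [← div_eq_mul_inv, div_le_iff₀ hb] at h2
    exact le_of_mul_le_mul_left (by linarith) hn

/-- The logarithms of the column factors form a Cauchy sequence. -/
theorem exists_tendsto_colScale [NeZero n] {α : ℝ} (hα : 0 < α)
    (hA : ∀ i j, A i j ∈ Set.Icc α 1) :
    ∃ y : Fin n → ℝ, (∀ j, 0 < y j) ∧ Tendsto (colScale A) atTop (𝓝 y) := by
  have hA0 : ∀ i j, 0 < A i j := fun i j => hα.trans_le (hA i j).1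
  obtain ⟨a₀, ha₀, D, θ, hθ1, h⟩ := exists_colScale_ratio_bounds hα hA
  have hlog : ∀ j, ∃ l, Tendsto (fun t => Real.log (colScale A t j)) atTop (𝓝 l) := by
    intro j
    refine cauchySeq_tendsto_of_complete
      (cauchySeq_of_le_geometric θ (D * a₀⁻¹) hθ1 fun t => ?_)
    obtain ⟨a, b, ha, hab, hj⟩ := h t
    have hapos : 0 < a := ha₀.trans_le ha
    obtain ⟨ha1, hb1⟩ := colScale_ratio_bounds_one hA0 hapos hj
    obtain ⟨hlo, hhi⟩ := hj j
    have hy := colScale_pos hA0 t j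
    have hy' := colScale_pos hA0 (t + 1) j
    set u := colScale A (t + 1) j / colScale A t j with hu
    have hupos : 0 < u := hapos.trans_le hlo
    have e : Real.log (colScale A (t + 1) j) - Real.log (colScale A t j) = Real.log u :=
      (Real.log_div hy'.ne' hy.ne').symm
    have h1 : 1 ≤ a₀⁻¹ := (one_le_inv₀ ha₀).2 (ha.trans ha1)
    have h2 : b - a ≤ (b - a) * a₀⁻¹ := le_mul_of_one_le_right (by linarith) h1
    have h3 : (b - a) * a₀⁻¹ ≤ D * a₀⁻¹ * θ ^ t := by
      calc (b - a) * a₀⁻¹ ≤ D * θ ^ t * a₀⁻¹ :=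
            mul_le_mul_of_nonneg_right hab (inv_pos.2 ha₀).le
        _ = _ := by ring
    rw [dist_comm, Real.dist_eq, e, abs_le]
    constructor
    · have h4 : 1 - u⁻¹ ≤ Real.log u := Real.one_sub_inv_le_log_of_pos hupos
      have h5 : u⁻¹ - 1 ≤ (b - a) * a₀⁻¹ := by
        have h6 : u⁻¹ ≤ a₀⁻¹ := inv_anti₀ ha₀ (ha.trans hlo)
        have e2 : u⁻¹ - 1 = (1 - u) * u⁻¹ := by
          rw [sub_mul, one_mul, mul_inv_cancel₀ hupos.ne']
        rw [e2]
        calc (1 - u) * u⁻¹ ≤ (b - a) * u⁻¹ :=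
              mul_le_mul_of_nonneg_right (by linarith) (inv_pos.2 hupos).le
          _ ≤ _ := mul_le_mul_of_nonneg_left h6 (by linarith)
      linarith
    · have := Real.log_le_sub_one_of_pos hupos
      linarith
  choose l hl using hlog
  refine ⟨fun j => Real.exp (l j), fun j => Real.exp_pos _, tendsto_pi_nhds.2 fun j => ?_⟩
  refine ((Real.continuous_exp.tendsto _).comp (hl j)).congr fun t => ?_
  exact Real.exp_log (colScale_pos hA0 t j)

/-- A square matrix with entries in `[α, 1]`, `α > 0`, is `(1, 1)`-scalable, and the
Sinkhorn–Knopp algorithm converges on it. -/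
theorem isScalable_and_converges [NeZero n] {α : ℝ} (hα : 0 < α)
    (hA : ∀ i j, A i j ∈ Set.Icc α 1) :
    IsScalable A 1 1 ∧ SinkhornKnoppConverges A := by
  have hA0 : ∀ i j, 0 < A i j := fun i j => hα.trans_le (hA i j).1
  obtain ⟨y, hy, hlim⟩ := exists_tendsto_colScale hα hA
  have hlimj : ∀ j, Tendsto (fun t => colScale A t j) atTop (𝓝 (y j)) :=
    tendsto_pi_nhds.1 hlim
  set x := rowFactor A y with hxdef
  have hx : ∀ i, 0 < x i := rowFactor_pos hA0 hy
  have hxlim : ∀ i, Tendsto (fun t => rowScale A t i) atTop (𝓝 (x i)) := fun i =>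
    (tendsto_finsetSum _ fun j _ => (hlimj j).const_mul (A i j)).inv₀
      (inv_pos.1 (hx i)).ne'
  have hycol : y = colFactor A x := by
    funext j
    refine tendsto_nhds_unique ((tendsto_add_atTop_iff_nat 1).2 (hlimj j)) ?_
    exact (tendsto_finsetSum _ fun i _ => (hxlim i).mul_const (A i j)).inv₀
      (inv_pos.1 (colFactor_pos hA0 hx j)).ne'
  have hrow : rowSum (scaled A x y) = 1 := funext fun i => rowSum_scaled_rowFactor hA0 hy i
  have hcol : colSum (scaled A x y) = 1 := funext fun j => by
    rw [hycol]; exact colSum_scaled_colFactor hA0 hx j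
  refine ⟨⟨fun i j => (hA0 i j).le, x, y, hx, hy, ?_, ?_⟩, scaled A x y, ?_, ?_⟩
  · rw [diagonal_mul_mul_diagonal_eq_scaled, hrow]
  · rw [diagonal_mul_mul_diagonal_eq_scaled, hcol]
  · rw [mem_doublyStochastic_iff_sum]
    exact ⟨fun i j => (mul_pos (mul_pos (hx i) (hA0 i j)) (hy j)).le,
      fun i => congrFun hrow i, fun j => congrFun hcol j⟩
  · have heven : Tendsto (fun t => sinkhornKnopp A (2 * t)) atTop (𝓝 (scaled A x y)) := by
      simp only [fun t => (sinkhornKnopp_even_odd hA0 t).1]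
      refine tendsto_pi_nhds.2 fun i => tendsto_pi_nhds.2 fun j => ?_
      exact ((hxlim i).mul_const _).mul (hlimj j)
    have hodd : Tendsto (fun t => sinkhornKnopp A (2 * t + 1)) atTop (𝓝 (scaled A x y)) := by
      simp only [fun t => (sinkhornKnopp_even_odd hA0 t).2]
      refine tendsto_pi_nhds.2 fun i => tendsto_pi_nhds.2 fun j => ?_
      exact ((hxlim i).mul_const _).mul ((tendsto_add_atTop_iff_nat 1).2 (hlimj j))
    rw [tendsto_def] at heven hodd ⊢
    intro s hs
    obtain ⟨N₁, h₁⟩ := mem_atTop_sets.1 (heven s hs)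
    obtain ⟨N₂, h₂⟩ := mem_atTop_sets.1 (hodd s hs)
    refine mem_atTop_sets.2 ⟨2 * (N₁ + N₂), fun k hk => ?_⟩
    obtain ⟨t, rfl | rfl⟩ := k.even_or_odd'
    · exact h₁ t (by omega)
    · exact h₂ t (by omega)

end

section

/-! ### The reduced dynamics -/

/-- The invariant at level `v` of a block-constant factor. Row factors and column factors are
treated alike by naming the blocks from the point of view of the current factor: `f` is its value
on the far block, `e` on the middle block of size two and `d` on the near block, so that a column
factor `(y₁, y₂, y₃)` is read as `(f, e, d) = (y₁, y₂, y₃)` and a row factor `(x₁, x₂, x₃)` as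
`(f, e, d) = (x₃, x₂, x₁)`. Here `s` is the line sum of the circulant blocks, and `(N, N')` is
`(h, h * m)` for column factors and `(h * m, h)` for row factors. `N * d / e` is the ratio of the
mass that a middle row (or column) has in the near block to its mass on the diagonal; it is to
vanish in the limit, and `mid_le` says that it is still at least `1 / v`. The bound `far_le` on the
ratio `f / e` propagates `mid_le` to the next factor. -/
structure SlowInv (h s N N' v f e d : ℝ) : Prop where
  far_pos : 0 < f
  mid_pos : 0 < e
  near_pos : 0 < d
  mid_le : e ≤ v * N * d
  far_le : s * f ≤ N' * (1 + v - 1 / h) * e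

/-- The parameters at which one normalization preserves `SlowInv`, with `β` negligible at
level `v`. -/
structure SlowParams (h s β N N' v : ℝ) : Prop where
  hpos : 1 ≤ h
  βpos : 0 < β
  one_le : 1 ≤ N
  one_le' : 1 ≤ N'
  le : N ≤ 2 * s
  le' : N' ≤ 2 * s
  two_le : 2 ≤ v
  small : 100 * (β * h ^ 2 * v ^ 3) ≤ 1

theorem SlowParams.symm {h s β N N' v : ℝ} (H : SlowParams h s β N N' v) :
    SlowParams h s β N' N v :=
  ⟨H.hpos, H.βpos, H.one_le', H.one_le, H.le', H.le, H.two_le, H.small⟩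

/-- One normalization raises the level by `2 / h` only: `1 / v` behaves like a solution of
`z (k + 1) = z k - (2 / h) * z k ^ 2`. The new factor is listed with its blocks in the order far,
middle, near, and the entries `β` enter through lower-order terms. -/
theorem SlowInv.step {h s β N N' v f e d : ℝ} (H : SlowParams h s β N N' v)
    (I : SlowInv h s N N' v f e d) :
    SlowInv h s N' N (v + 2 / h) (h * β * f + 2 * β * e + s * d)⁻¹
      (h * β * f + (1 + β) * e + N * d)⁻¹ (s * f + 2 * N' / h * e + h * β * d)⁻¹ := by
  obtain ⟨hh, hβ, hN, hN', hNs, hN's, hv, hsm⟩ := H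
  obtain ⟨hf, he, hd, h1, h2⟩ := I
  have hs : 0 < s := by linarith
  have hh0 : 0 < h := by linarith
  set w := 1 / h with hw
  have hw0 : 0 < w := by positivity
  have hhw : h * w = 1 := by rw [hw]; field_simp
  have e1 : 2 / h = 2 * w := by rw [hw]; ring
  have e2 : 2 * N' / h = 2 * N' * w := by rw [hw]; ring
  rw [e1, e2]
  have hw1 : w ≤ 1 := by nlinarith
  -- `β` is small enough to be absorbed by the slack `w = 1 / h` in the two bounds
  have hb1 : h * β ≤ 2 * w := by
    have h3 : (8 : ℝ) ≤ v ^ 3 := by nlinarith [mul_self_nonneg v]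
    have h4 : β * h ^ 2 * 8 ≤ β * h ^ 2 * v ^ 3 := by gcongr
    have h5 : h * (h * β) ≤ h * (2 * w) := by nlinarith
    exact le_of_mul_le_mul_left h5 hh0
  have hb2 : (2 * h * β * (1 + v) + β) * v ≤ w := by
    have h3 : h * ((2 * h * β * (1 + v) + β) * v) ≤ h * w := by
      rw [hhw]
      have h4 : (2 * h * β * (1 + v) + β) ≤ 4 * (h * β * v) := by
        have : β * (2 * h + 1) ≤ β * (2 * h * v) := by gcongr; nlinarith
        nlinarith
      have h5 : h * ((2 * h * β * (1 + v) + β) * v) ≤ h * (4 * (h * β * v) * v) := by gcongr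
      have h6 : β * h ^ 2 * v ^ 2 ≤ β * h ^ 2 * v ^ 3 := by
        gcongr <;> linarith
      nlinarith
    exact le_of_mul_le_mul_left h3 hh0
  have hN0 : 0 < N := by linarith
  have hN'0 : 0 < N' := by linarith
  refine ⟨by positivity, by positivity, by positivity, ?_, ?_⟩
  · rw [inv_le_iff_one_le_mul₀ (by positivity), ← div_eq_mul_inv, div_mul_eq_mul_div,
      le_div_iff₀ (by positivity), one_mul]
    have h3 : (v + 2 * w) * N' * (e + N * d) ≤
        (v + 2 * w) * N' * (h * β * f + (1 + β) * e + N * d) := by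
      gcongr
      nlinarith [mul_pos (mul_pos hh0 hβ) hf, mul_pos hβ he]
    have h4 : N' * e ≤ N' * (v * N * d) := by gcongr
    have h5 : h * β * d ≤ 2 * w * (N' * N) * d := by
      have : 1 ≤ N' * N := one_le_mul_of_one_le_of_one_le hN' hN
      calc h * β * d ≤ 2 * w * 1 * d := by rw [mul_one]; gcongr
        _ ≤ 2 * w * (N' * N) * d := by gcongr
    have h6 : 0 ≤ N' * w * e := by positivity
    linarith
  · rw [← div_eq_mul_inv, ← div_eq_mul_inv, div_le_div_iff₀ (by positivity) (by positivity)]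
    have h3 : N * (1 + (v + 2 * w) - w) * (s * d) ≤
        N * (1 + (v + 2 * w) - w) * (h * β * f + 2 * β * e + s * d) := by
      have : 0 ≤ N * (1 + (v + 2 * w) - w) := by nlinarith
      gcongr
      nlinarith [mul_pos (mul_pos hh0 hβ) hf, mul_pos hβ he]
    refine le_trans ?_ h3
    have h4 : h * β * (s * f) ≤ h * β * (2 * s * (1 + v) * e) := by
      refine mul_le_mul_of_nonneg_left (h2.trans ?_) (by positivity)
      exact mul_le_mul_of_nonneg_right
        (mul_le_mul hN's (by linarith) (by linarith) (by linarith)) he.le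
    have h5 : s * e ≤ s * (v * N * d) := by gcongr
    have h6 : s * (2 * h * β * (1 + v) + β) * e ≤
        s * (2 * h * β * (1 + v) + β) * (v * N * d) := by gcongr
    have h7 : s * N * d * ((2 * h * β * (1 + v) + β) * v) ≤ s * N * d * w := by gcongr
    linarith

/-- After the normalization, each of the `h` lines through the near block has a sum exceeding `1`,
by at least `1 / (2 * h * v)`: the mass leaking in through the middle block, of order
`(N * d / e) / (1 + N * d / e)` in total, is not compensated by what the tiny entries `β` take away from the circulant block. -/
theorem SlowInv.excess {h s β N N' v f e d : ℝ} (H : SlowParams h s β N N' v)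
    (I : SlowInv h s N N' v f e d) :
    1 / (2 * v) ≤ h * (d * (s * (h * β * f + 2 * β * e + s * d)⁻¹ +
      2 * N / h * (h * β * f + (1 + β) * e + N * d)⁻¹ +
      h * β * (s * f + 2 * N' / h * e + h * β * d)⁻¹) - 1) := by
  obtain ⟨hh, hβ, hN, hN', hNs, hN's, hv, hsm⟩ := H
  obtain ⟨hf, he, hd, h1, h2⟩ := I
  have hs : 0 < s := by linarith
  have hh0 : 0 < h := by linarith
  have hN0 : 0 < N := by linarith
  have hN'0 : 0 < N' := by linarith
  have hv0 : 0 < v := by linarith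
  have hfe : f ≤ 2 * (1 + v) * e := by
    have h3 : s * f ≤ s * (2 * (1 + v) * e) := by
      calc s * f ≤ N' * (1 + v - 1 / h) * e := h2
        _ ≤ (2 * s) * (1 + v) * e := by
          have : 0 < 1 / h := by positivity
          have h6 : 1 / h ≤ 1 := by rw [div_le_one hh0]; exact hh
          gcongr
          · linarith
          · linarith
        _ = _ := by ring
    exact le_of_mul_le_mul_left h3 hs
  set R := h * β * f + 2 * β * e with hR
  have hR0 : 0 < R := by positivity
  have hRe : R ≤ 4 * (h * β * v) * e := by
    have h3 : h * β * f ≤ h * β * (2 * (1 + v) * e) := by gcongr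
    have h4 : 2 * β * e ≤ 2 * β * (h * e) := by
      gcongr
      exact le_mul_of_one_le_left he.le hh
    have h5 : h * β * (4 * e) ≤ h * β * (2 * v * e) := by
      gcongr; linarith
    nlinarith
  -- the leading term of the excess
  have hlead : 4 / (5 * v) ≤ h * (d * (2 * N / h * (h * β * f + (1 + β) * e + N * d)⁻¹)) := by
    have e3 : h * (d * (2 * N / h * (h * β * f + (1 + β) * e + N * d)⁻¹)) =
        2 * (N * d) / (h * β * f + (1 + β) * e + N * d) := by field_simp
    rw [e3, div_le_div_iff₀ (by positivity) (by positivity)]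
    have h3 : h * β * f + β * e ≤ v * N * d := by
      have h4 : 4 * (h * β * v) ≤ 1 := by
        have h7 : β * h * v * 4 ≤ β * h ^ 2 * v ^ 3 := by
          have : (4 : ℝ) ≤ v ^ 2 := by nlinarith
          calc β * h * v * 4 ≤ β * h * v * v ^ 2 := by gcongr
            _ ≤ β * h * v * v ^ 2 * h := le_mul_of_one_le_right (by positivity) hh
            _ = _ := by ring
        linarith
      have h6 : 4 * (h * β * v) * e ≤ 1 * e := by gcongr
      have : 0 < β * e := by positivity
      linarith
    have h5 : 0 < N * d := by positivity
    nlinarith [mul_le_mul_of_nonneg_right hv h5.le]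
  -- the loss in the dominant entries
  have hloss : -(3 / (10 * v)) ≤ h * (d * (s * (R + s * d)⁻¹) - 1) := by
    have e3 : h * (d * (s * (R + s * d)⁻¹) - 1) = -(h * R / (R + s * d)) := by
      field_simp; ring
    rw [e3, neg_le_neg_iff, div_le_div_iff₀ (by positivity) (by positivity)]
    have h3 : h * R ≤ h * (4 * (h * β * v) * (v * (2 * s) * d)) := by
      have : e ≤ v * (2 * s) * d := h1.trans (by gcongr)
      have h4 : R ≤ 4 * (h * β * v) * (v * (2 * s) * d) := hRe.trans (by gcongr)
      gcongr
    have h4 : h * R * (10 * v) ≤ (80 * (β * h ^ 2 * v ^ 3)) * (s * d) := by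
      calc h * R * (10 * v) ≤ h * (4 * (h * β * v) * (v * (2 * s) * d)) * (10 * v) := by gcongr
        _ = _ := by ring
    have h5 : (80 * (β * h ^ 2 * v ^ 3)) * (s * d) ≤ 1 * (s * d) := by
      gcongr; linarith
    nlinarith [mul_pos hs hd]
  have hlast : 0 ≤ h * (d * (h * β * (s * f + 2 * N' / h * e + h * β * d)⁻¹)) := by positivity
  -- `1 / 2 = 4 / 5 - 3 / 10`
  have e4 : 1 / (2 * v) = 4 / (5 * v) + -(3 / (10 * v)) := by field_simp; norm_num
  rw [e4]
  nlinarith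

end

section

/-! ### Block structure of the matrix -/

/-- Each row of a circulant block of size `h` and width `g` has `g` ones. -/
theorem card_filter_add_emod_lt {h g : ℕ} (hh : 0 < h) (hg : g ≤ h) (d : ℤ) :
    ((Finset.range h).filter fun u : ℕ => ((u : ℤ) + d) % (h : ℤ) < (g : ℤ)).card = g := by
  have hh' : (0 : ℤ) < h := by exact_mod_cast hh
  have hper : Function.Periodic (fun u : ℕ => ((u : ℤ) + d) % (h : ℤ) < (g : ℤ)) h := by
    intro u
    have : ((u + h : ℕ) : ℤ) + d = (u + d) + h := by push_cast; ring
    simp only [this, Int.add_emod_right]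
  obtain ⟨a, ha⟩ : ∃ a : ℕ, (a : ℤ) = (-d) % h :=
    ⟨((-d) % h).toNat, Int.toNat_of_nonneg (Int.emod_nonneg _ hh'.ne')⟩
  have hmod : ∀ v : ℤ, 0 ≤ v → v < h → (a + v + d) % h = v := by
    intro v h0 h1
    have e : (a : ℤ) + v + d = v + h * (-((-d) / h)) := by
      have := Int.emod_add_mul_ediv (-d) h
      rw [ha]; linarith
    rw [e, Int.add_mul_emod_self_left, Int.emod_eq_of_lt h0 h1]
  have h1 := Nat.filter_Ico_card_eq_of_periodic a h _ hper
  have h0 := Nat.filter_Ico_card_eq_of_periodic 0 h _ hper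
  rw [zero_add, ← Finset.range_eq_Ico, ← h1] at h0
  rw [h0]
  have : (Finset.Ico a (a + h)).filter (fun u : ℕ => ((u : ℤ) + d) % (h : ℤ) < (g : ℤ)) =
      Finset.Ico a (a + g) := by
    ext u
    simp only [Finset.mem_filter, Finset.mem_Ico]
    have key : a ≤ u → u < a + h → ((u : ℤ) + d) % h = u - a := by
      intro h2 h3
      have := hmod (u - a) (by omega) (by omega)
      rwa [add_sub_cancel] at this
    constructor
    · rintro ⟨⟨h2, h3⟩, h4⟩
      rw [key h2 h3] at h4
      omega
    · rintro ⟨h2, h3⟩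
      have h4 : u < a + h := by omega
      refine ⟨⟨h2, h4⟩, ?_⟩
      rw [key h2 h4]
      omega
  rw [this, Nat.card_Ico]
  omega

/-- Each column of a circulant block of size `h` and width `g` has `g` ones. -/
theorem card_filter_sub_emod_lt {h g : ℕ} (hh : 0 < h) (hg : g ≤ h) (d : ℤ) :
    ((Finset.range h).filter fun u : ℕ => (d - (u : ℤ)) % (h : ℤ) < (g : ℤ)).card = g := by
  refine (Finset.card_bij (fun u _ => h - 1 - u) ?_ ?_ ?_).trans
    (card_filter_add_emod_lt hh hg (d - (h - 1 : ℤ)))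
  · intro u hu
    simp only [Finset.mem_filter, Finset.mem_range] at hu ⊢
    refine ⟨by omega, ?_⟩
    have : ((h - 1 - u : ℕ) : ℤ) + (d - (h - 1 : ℤ)) = d - u := by omega
    rw [this]; exact hu.2
  · intro u hu v hv huv
    simp only [Finset.mem_filter, Finset.mem_range] at hu hv
    omega
  · intro v hv
    simp only [Finset.mem_filter, Finset.mem_range] at hv ⊢
    refine ⟨h - 1 - v, ⟨by omega, ?_⟩, by omega⟩
    have : d - ((h - 1 - v : ℕ) : ℤ) = v + (d - (h - 1 : ℤ)) := by omega
    rw [this]; exact hv.2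

/-- The entries of `slowMatrix` with the `0`-based indices split into the blocks
`[0, h)`, `{h, h + 1}` and `[h + 2, 2 * h + 2)`. -/
def blockEntry (h g : ℕ) (m β : ℝ) (i j : ℕ) : ℝ :=
  if i < h then
    if j < h then if ((j : ℤ) - i) % h < g then 1 else β else if j < h + 2 then m else β
  else if i < h + 2 then
    if j < h then β else if j < h + 2 then if i = j then 1 else β else 1
  else if j < h + 2 then β else if ((j : ℤ) - i) % h < g then 1 else β

theorem slowMatrix_eq_blockEntry (h : ℕ) (γ ε : ℝ) (i j : Fin (2 * h + 2)) :
    slowMatrix (2 * h + 2) γ ε i j =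
      blockEntry h ⌈γ * ((2 * h + 2 : ℕ) : ℝ)⌉₊
        (2 * (⌈γ * ((2 * h + 2 : ℕ) : ℝ)⌉₊ : ℝ) / ((2 * h + 2 : ℕ) : ℝ))
        (ε ^ 8 / (100 * ((2 * h + 2 : ℕ) : ℝ) ^ 61)) i j := by
  have h1 : (2 * h + 2) / 2 = h + 1 := by omega
  have h2 : (((j : ℕ) + 1 : ℕ) : ℤ) - (((i : ℕ) + 1 : ℕ) : ℤ) = (j : ℤ) - (i : ℤ) := by
    push_cast; ring
  simp only [slowMatrix, Matrix.of_apply, IsOnePos, IsMidPos, blockEntry, h1, h2,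
    Nat.add_sub_cancel]
  generalize ((j : ℤ) - (i : ℤ)) % (h : ℤ) = r
  split_ifs <;> first | rfl | omega

theorem sum_fin_blocks (h : ℕ) (F : ℕ → ℝ) :
    ∑ j : Fin (2 * h + 2), F j = ∑ j ∈ Finset.range h, F j + (F h + F (h + 1)) +
      ∑ u ∈ Finset.range h, F (h + 2 + u) := by
  rw [Fin.sum_univ_eq_sum_range, show 2 * h + 2 = h + 2 + h by ring, Finset.sum_range_add,
    Finset.sum_range_add, Finset.sum_range_succ, Finset.sum_range_one]
  rfl

/-- The vector with value `a` on `[0, h)`, `b` on `{h, h + 1}` and `c` from `h + 2` on. -/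
def blockVec (h : ℕ) (a b c : ℝ) (j : ℕ) : ℝ := if j < h then a else if j < h + 2 then b else c

theorem sum_ite_const {h g : ℕ} {p : ℕ → Prop} [DecidablePred p]
    (hp : ((Finset.range h).filter p).card = g) (β a : ℝ) :
    ∑ u ∈ Finset.range h, (if p u then 1 else β) * a = (g + (h - g) * β) * a := by
  rw [← Finset.sum_mul, Finset.sum_ite, Finset.sum_const, Finset.sum_const, hp]
  have h1 := Finset.card_filter_add_card_filter_not (s := Finset.range h) p
  rw [hp, Finset.card_range] at h1
  have h2 : (h : ℝ) = g + ((Finset.range h).filter fun u => ¬ p u).card := by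
    exact_mod_cast h1.symm
  rw [h2]
  simp

variable {h g : ℕ} {m β : ℝ}

/-- The matrix maps block-constant vectors to block-constant vectors. -/
theorem sum_blockEntry_mul (hh : 0 < h) (hg : g ≤ h) (a b c : ℝ) {i : ℕ} :
    ∑ j : Fin (2 * h + 2), blockEntry h g m β i j * blockVec h a b c j =
      blockVec h ((g + (h - g) * β) * a + 2 * m * b + h * β * c)
        (h * β * a + (1 + β) * b + h * c)
        (h * β * a + 2 * β * b + (g + (h - g) * β) * c) i := by
  rw [sum_fin_blocks h fun j => blockEntry h g m β i j * blockVec h a b c j]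
  by_cases h1 : i < h
  · have e1 : ∀ j ∈ Finset.range h, blockEntry h g m β i j * blockVec h a b c j =
        (if ((j : ℤ) + -i) % h < g then 1 else β) * a := by
      intro j hj
      rw [Finset.mem_range] at hj
      simp [blockEntry, blockVec, h1, hj, sub_eq_add_neg]
    have e2 : ∀ u ∈ Finset.range h, blockEntry h g m β i (h + 2 + u) *
        blockVec h a b c (h + 2 + u) = β * c := by
      intro u _
      simp [blockEntry, blockVec, h1, show ¬ h + 2 + u < h by omega]
    rw [Finset.sum_congr rfl e1, Finset.sum_congr rfl e2,
      sum_ite_const (card_filter_add_emod_lt hh hg _)]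
    simp [blockEntry, blockVec, h1]
    ring
  by_cases h2 : i < h + 2
  · have e1 : ∀ j ∈ Finset.range h, blockEntry h g m β i j * blockVec h a b c j = β * a := by
      intro j hj
      rw [Finset.mem_range] at hj
      simp [blockEntry, blockVec, h1, h2, hj]
    have e2 : ∀ u ∈ Finset.range h, blockEntry h g m β i (h + 2 + u) *
        blockVec h a b c (h + 2 + u) = 1 * c := by
      intro u _
      simp [blockEntry, blockVec, h1, h2, show ¬ h + 2 + u < h by omega]
    rw [Finset.sum_congr rfl e1, Finset.sum_congr rfl e2]
    obtain rfl | rfl : i = h ∨ i = h + 1 := by omega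
    · simp [blockEntry, blockVec]
      ring
    · simp [blockEntry, blockVec]
      ring
  · have e1 : ∀ j ∈ Finset.range h, blockEntry h g m β i j * blockVec h a b c j = β * a := by
      intro j hj
      rw [Finset.mem_range] at hj
      simp [blockEntry, blockVec, h1, h2, hj, show j < h + 2 by omega]
    have e2 : ∀ u ∈ Finset.range h, blockEntry h g m β i (h + 2 + u) *
        blockVec h a b c (h + 2 + u) =
        (if ((u : ℤ) + (h + 2 - i)) % h < g then 1 else β) * c := by
      intro u _
      have : ((h + 2 + u : ℕ) : ℤ) - i = u + (h + 2 - i) := by push_cast; ring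
      simp only [blockEntry, blockVec, h1, h2, this]
      simp [show ¬ h + 2 + u < h by omega]
    rw [Finset.sum_congr rfl e1, Finset.sum_congr rfl e2,
      sum_ite_const (card_filter_add_emod_lt hh hg _)]
    simp [blockEntry, blockVec, h1, h2]
    ring

/-- The transposed matrix maps block-constant vectors to block-constant vectors. -/
theorem sum_mul_blockEntry (hh : 0 < h) (hg : g ≤ h) (a b c : ℝ) {j : ℕ} :
    ∑ i : Fin (2 * h + 2), blockVec h a b c i * blockEntry h g m β i j =
      blockVec h ((g + (h - g) * β) * a + 2 * β * b + h * β * c)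
        (h * m * a + (1 + β) * b + h * β * c)
        (h * β * a + 2 * b + (g + (h - g) * β) * c) j := by
  rw [sum_fin_blocks h fun i => blockVec h a b c i * blockEntry h g m β i j]
  simp only [mul_comm (blockVec h a b c _)]
  by_cases h1 : j < h
  · have e1 : ∀ i ∈ Finset.range h, blockEntry h g m β i j * blockVec h a b c i =
        (if ((j : ℤ) - i) % h < g then 1 else β) * a := by
      intro i hi
      rw [Finset.mem_range] at hi
      simp [blockEntry, blockVec, h1, hi]
    have e2 : ∀ u ∈ Finset.range h, blockEntry h g m β (h + 2 + u) j *
        blockVec h a b c (h + 2 + u) = β * c := by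
      intro u _
      simp [blockEntry, blockVec, show ¬ h + 2 + u < h by omega, show j < h + 2 by omega]
    rw [Finset.sum_congr rfl e1, Finset.sum_congr rfl e2,
      sum_ite_const (card_filter_sub_emod_lt hh hg _)]
    simp [blockEntry, blockVec, h1]
    ring
  by_cases h2 : j < h + 2
  · have e1 : ∀ i ∈ Finset.range h, blockEntry h g m β i j * blockVec h a b c i = m * a := by
      intro i hi
      rw [Finset.mem_range] at hi
      simp [blockEntry, blockVec, h1, h2, hi]
    have e2 : ∀ u ∈ Finset.range h, blockEntry h g m β (h + 2 + u) j *
        blockVec h a b c (h + 2 + u) = β * c := by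
      intro u _
      simp [blockEntry, blockVec, h2, show ¬ h + 2 + u < h by omega]
    rw [Finset.sum_congr rfl e1, Finset.sum_congr rfl e2]
    obtain rfl | rfl : j = h ∨ j = h + 1 := by omega
    · simp [blockEntry, blockVec]
      ring
    · simp [blockEntry, blockVec]
      ring
  · have e1 : ∀ i ∈ Finset.range h, blockEntry h g m β i j * blockVec h a b c i = β * a := by
      intro i hi
      rw [Finset.mem_range] at hi
      simp [blockEntry, blockVec, h1, h2, hi]
    have e2 : ∀ u ∈ Finset.range h, blockEntry h g m β (h + 2 + u) j *
        blockVec h a b c (h + 2 + u) =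
        (if ((j - (h + 2) : ℤ) - u) % h < g then 1 else β) * c := by
      intro u _
      have : (j : ℤ) - ((h + 2 + u : ℕ) : ℤ) = (j - (h + 2)) - u := by push_cast; ring
      simp only [blockEntry, blockVec, h2, this]
      simp [show ¬ h + 2 + u < h by omega]
    rw [Finset.sum_congr rfl e1, Finset.sum_congr rfl e2,
      sum_ite_const (card_filter_sub_emod_lt hh hg _)]
    simp [blockEntry, blockVec, h1, h2]
    ring

theorem inv_blockVec (h : ℕ) (a b c : ℝ) (j : ℕ) :
    (blockVec h a b c j)⁻¹ = blockVec h a⁻¹ b⁻¹ c⁻¹ j := by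
  unfold blockVec
  split_ifs <;> rfl

theorem blockEntry_mem_Icc (hβ : β ≤ 1) (hm : m ∈ Set.Icc β 1) (i j : ℕ) :
    blockEntry h g m β i j ∈ Set.Icc β 1 := by
  unfold blockEntry
  split_ifs <;> first | exact hm | exact ⟨hβ, le_rfl⟩ | exact ⟨le_rfl, hβ⟩

end

section

/-- `slowMatrix` in terms of the block size `h`, the width `g` of the circulant bands, the middle
value `m` and the small value `β`, which are treated as independent parameters. -/
def blockMatrix (h g : ℕ) (m β : ℝ) : Matrix (Fin (2 * h + 2)) (Fin (2 * h + 2)) ℝ :=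
  Matrix.of fun i j => blockEntry h g m β i j

theorem slowMatrix_eq_blockMatrix (h : ℕ) (γ ε : ℝ) :
    slowMatrix (2 * h + 2) γ ε = blockMatrix h ⌈γ * ((2 * h + 2 : ℕ) : ℝ)⌉₊
      (2 * (⌈γ * ((2 * h + 2 : ℕ) : ℝ)⌉₊ : ℝ) / ((2 * h + 2 : ℕ) : ℝ))
      (ε ^ 8 / (100 * ((2 * h + 2 : ℕ) : ℝ) ^ 61)) := by
  ext i j
  exact slowMatrix_eq_blockEntry h γ ε i j

/-- The constraints on the parameters of `blockMatrix`. -/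
structure BlockParams (h g : ℕ) (m β : ℝ) : Prop where
  two_le : 2 ≤ h
  le : g ≤ h
  half_le : h ≤ 2 * g
  mid_ge : 1 / 2 ≤ m
  mid_le : m ≤ 1
  pos : 0 < β
  lt_half : β < 1 / 2

variable {h g : ℕ} {m β : ℝ}

theorem BlockParams.mem_Icc (H : BlockParams h g m β) (i j : Fin (2 * h + 2)) :
    blockMatrix h g m β i j ∈ Set.Icc β 1 :=
  blockEntry_mem_Icc (by linarith [H.lt_half]) ⟨by linarith [H.lt_half, H.mid_ge], H.mid_le⟩ i j

theorem BlockParams.entry_pos (H : BlockParams h g m β) (i j : Fin (2 * h + 2)) :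
    0 < blockMatrix h g m β i j :=
  H.pos.trans_le (H.mem_Icc i j).1

/-- The indicator of the large entries is again a block matrix, with `m = 1` and `β = 0`. -/
theorem BlockParams.ite_half_le (H : BlockParams h g m β) (i j : ℕ) :
    (if 1 / 2 ≤ blockEntry h g m β i j then (1 : ℝ) else 0) = blockEntry h g 1 0 i j := by
  have hm := H.mid_ge
  have hβ := not_le.2 H.lt_half
  have h1 : (1 / 2 : ℝ) ≤ 1 := by norm_num
  unfold blockEntry
  split_ifs <;> rfl

theorem ncard_eq_sum_ite {N : ℕ} (p : Fin N → Prop) [DecidablePred p] :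
    ({j | p j}.ncard : ℝ) = ∑ j, if p j then (1 : ℝ) else 0 := by
  rw [Finset.sum_boole, Set.ncard_eq_toFinset_card']
  simp

theorem BlockParams.rowCount_eq (H : BlockParams h g m β) (i : Fin (2 * h + 2)) :
    (rowCount (1 / 2) (blockMatrix h g m β) i : ℝ) = blockVec h (g + 2) (1 + h) g i := by
  have h0 : 0 < h := by have := H.two_le; omega
  have h1 := sum_blockEntry_mul (m := 1) (β := 0) h0 H.le 1 1 1 (i := i)
  rw [rowCount, ncard_eq_sum_ite]
  refine (Finset.sum_congr rfl fun (j : Fin (2 * h + 2)) _ => H.ite_half_le i j).trans ?_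
  have h2 : ∀ j, blockVec h 1 1 1 j = 1 := fun j => by simp [blockVec]
  simp only [h2, mul_one] at h1
  rw [h1]
  simp

theorem BlockParams.colCount_eq (H : BlockParams h g m β) (j : Fin (2 * h + 2)) :
    (colCount (1 / 2) (blockMatrix h g m β) j : ℝ) = blockVec h g (h + 1) (2 + g) j := by
  have h0 : 0 < h := by have := H.two_le; omega
  have h1 := sum_mul_blockEntry (m := 1) (β := 0) h0 H.le 1 1 1 (j := j)
  rw [colCount, ncard_eq_sum_ite]
  refine (Finset.sum_congr rfl fun (i : Fin (2 * h + 2)) _ => H.ite_half_le i j).trans ?_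
  have h2 : ∀ j, blockVec h 1 1 1 j = 1 := fun j => by simp [blockVec]
  simp only [h2, one_mul] at h1
  rw [h1]
  simp

theorem BlockParams.isDenseMatrix (H : BlockParams h g m β) {γ : ℝ}
    (hg : ⌈γ * ((2 * h + 2 : ℕ) : ℝ)⌉₊ = g) :
    IsDenseMatrix γ (1 / 2) (blockMatrix h g m β) := by
  have hgh : (g : ℝ) ≤ h := by exact_mod_cast H.le
  refine ⟨fun i j => ⟨(H.entry_pos i j).le, (H.mem_Icc i j).2⟩, Or.inr ⟨0, ?_⟩, fun i => ?_,
    fun j => ?_⟩ <;> rw [hg]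
  · have h1 := H.colCount_eq 0
    have h0 : 0 < h := by have := H.two_le; omega
    simp only [blockVec, Fin.val_zero, h0, if_true] at h1
    exact_mod_cast h1
  · have h1 := H.rowCount_eq i
    have h2 : (g : ℝ) ≤ blockVec h (g + 2) (1 + h) g i := by
      unfold blockVec
      split_ifs <;> linarith
    rw [← h1] at h2
    exact_mod_cast h2
  · have h1 := H.colCount_eq j
    have h2 : (g : ℝ) ≤ blockVec h g (h + 1) (2 + g) j := by
      unfold blockVec
      split_ifs <;> linarith
    rw [← h1] at h2
    exact_mod_cast h2

/-! ### The error along the iteration -/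

/-- The common sum of the rows and columns of the circulant blocks. -/
def bandSum (h g : ℕ) (β : ℝ) : ℝ := g + (h - g) * β

theorem BlockParams.slowParams (H : BlockParams h g m β) {v V : ℝ} (hv : 2 ≤ v) (hvV : v ≤ V)
    (hV : 100 * (β * (h : ℝ) ^ 2 * V ^ 3) ≤ 1) :
    SlowParams h (bandSum h g β) β h (h * m) v := by
  have h2 : (2 : ℝ) ≤ h := by exact_mod_cast H.two_le
  have hgh : (g : ℝ) ≤ h := by exact_mod_cast H.le
  have hg : (h : ℝ) ≤ 2 * g := by exact_mod_cast H.half_le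
  have hβ := H.pos
  have hs : (g : ℝ) ≤ bandSum h g β := by
    have : 0 ≤ ((h : ℝ) - g) * β := mul_nonneg (by linarith) hβ.le
    unfold bandSum; linarith
  have hm : (h : ℝ) * m ≤ h := mul_le_of_le_one_right (by linarith) H.mid_le
  refine ⟨by linarith, hβ, by linarith, ?_, by linarith, by linarith, hv, le_trans ?_ hV⟩
  · nlinarith [H.mid_ge]
  · gcongr

theorem BlockParams.rowScale_eq (H : BlockParams h g m β) {t : ℕ} {a b c : ℝ}
    (hy : colScale (blockMatrix h g m β) t = fun j : Fin (2 * h + 2) => blockVec h a b c j) :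
    rowScale (blockMatrix h g m β) t = fun i : Fin (2 * h + 2) =>
      blockVec h (bandSum h g β * a + 2 * (h * m) / h * b + h * β * c)⁻¹
        (h * β * a + (1 + β) * b + h * c)⁻¹ (h * β * a + 2 * β * b + bandSum h g β * c)⁻¹ i := by
  have h0 : 0 < h := by have := H.two_le; omega
  have h0' : (h : ℝ) ≠ 0 := by positivity
  funext i
  rw [rowScale, rowFactor, hy, ← inv_blockVec]
  have e : 2 * (h * m) / h = 2 * m := by field_simp
  rw [e]
  exact congrArg _ (sum_blockEntry_mul h0 H.le a b c)

theorem BlockParams.colScale_succ_eq (H : BlockParams h g m β) {t : ℕ} {a b c : ℝ}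
    (hx : rowScale (blockMatrix h g m β) t = fun i : Fin (2 * h + 2) => blockVec h a b c i) :
    colScale (blockMatrix h g m β) (t + 1) = fun j : Fin (2 * h + 2) =>
      blockVec h (h * β * c + 2 * β * b + bandSum h g β * a)⁻¹
        (h * β * c + (1 + β) * b + h * m * a)⁻¹
        (bandSum h g β * c + 2 * h / h * b + h * β * a)⁻¹ j := by
  have h0 : 0 < h := by have := H.two_le; omega
  have h0' : (h : ℝ) ≠ 0 := by positivity
  funext j
  change colFactor _ (rowScale _ t) j = _
  rw [colFactor, hx, ← inv_blockVec]
  have e : 2 * (h : ℝ) / h = 2 := by field_simp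
  have := sum_mul_blockEntry (m := m) (β := β) h0 H.le a b c (j := j)
  refine congrArg _ (this.trans ?_)
  rw [e]
  unfold blockVec bandSum
  split_ifs <;> ring

/-- The factors stay block-constant, and the column factors before row normalization number `2 t`
satisfy the invariant at level `2 + (2 / h) * (2 t)`. -/
theorem BlockParams.exists_slowInv (H : BlockParams h g m β) {V : ℝ}
    (hV : 100 * (β * (h : ℝ) ^ 2 * V ^ 3) ≤ 1) (t : ℕ) (ht : 2 + 2 / h * (2 * t : ℝ) ≤ V) :
    ∃ a b c, colScale (blockMatrix h g m β) t = (fun j : Fin (2 * h + 2) => blockVec h a b c j) ∧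
      SlowInv h (bandSum h g β) h (h * m) (2 + 2 / h * (2 * t : ℝ)) a b c := by
  have h2 : (2 : ℝ) ≤ h := by exact_mod_cast H.two_le
  have hw : 0 < 2 / (h : ℝ) := by positivity
  induction t with
  | zero =>
    refine ⟨1, 1, 1, ?_, one_pos, one_pos, one_pos, ?_, ?_⟩
    · funext j; simp [colScale, blockVec]
    -- all factors are `1` at the start, where level `2` leaves room
    · simp; linarith
    · have hgh : (g : ℝ) ≤ h := by exact_mod_cast H.le
      have hs : bandSum h g β ≤ h := by
        unfold bandSum
        nlinarith [H.lt_half]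
      have hm := H.mid_ge
      have hinv : 1 / (h : ℝ) ≤ 1 := by rw [div_le_one (by linarith)]; linarith
      push_cast
      have h3 : (h : ℝ) * (1 / 2) * (1 + 2 - 1) ≤ h * m * (1 + 2 - 1 / h) := by gcongr
      simp only [mul_zero, add_zero, mul_one]
      linarith
  | succ t ih =>
    push_cast at ht ⊢
    obtain ⟨a, b, c, hy, I⟩ := ih (by nlinarith)
    have P := H.slowParams (v := 2 + 2 / h * (2 * t : ℝ)) (by
      have : 0 ≤ 2 / (h : ℝ) * (2 * t) := by positivity
      linarith) (by nlinarith) hV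
    have P' := H.slowParams (v := 2 + 2 / h * (2 * t : ℝ) + 2 / h) (by
      have : 0 ≤ 2 / (h : ℝ) * (2 * t) := by positivity
      linarith) (by nlinarith) hV
    have I' := (I.step P).step P'.symm
    refine ⟨_, _, _, H.colScale_succ_eq (H.rowScale_eq hy), ?_⟩
    convert I' using 1
    ring

theorem norm_toLp_bounds {v : Fin (2 * h + 2) → ℝ} {S : Finset (Fin (2 * h + 2))} {d : ℝ}
    (hS : S.card = h) (hd : 0 ≤ d) (hv : ∀ j ∈ S, v j = d) :
    h * d ≤ ‖WithLp.toLp 1 v‖ ∧ √h * d ≤ ‖WithLp.toLp 2 v‖ := by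
  constructor
  · rw [PiLp.norm_eq_of_L1]
    calc h * d = ∑ j ∈ S, ‖v j‖ := by
          rw [Finset.sum_congr rfl fun j hj => by rw [hv j hj, Real.norm_of_nonneg hd],
            Finset.sum_const, hS, nsmul_eq_mul]
      _ ≤ ∑ j, ‖v j‖ := Finset.sum_le_univ_sum_of_nonneg fun j => norm_nonneg _
  · rw [EuclideanSpace.norm_eq, ← Real.sqrt_sq hd, ← Real.sqrt_mul (by positivity)]
    apply Real.sqrt_le_sqrt
    calc h * d ^ 2 = ∑ j ∈ S, ‖v j‖ ^ 2 := by
          rw [Finset.sum_congr rfl fun j hj => by rw [hv j hj, Real.norm_of_nonneg hd],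
            Finset.sum_const, hS, nsmul_eq_mul]
      _ ≤ ∑ j, ‖v j‖ ^ 2 := Finset.sum_le_univ_sum_of_nonneg fun j => by positivity

theorem card_filter_lt_block (h : ℕ) :
    (Finset.univ.filter fun j : Fin (2 * h + 2) => (j : ℕ) < h).card = h := by
  rw [Fin.card_filter_val_lt]
  omega

theorem card_filter_ge_block (h : ℕ) :
    (Finset.univ.filter fun j : Fin (2 * h + 2) => h + 2 ≤ (j : ℕ)).card = h := by
  have h1 := Finset.card_filter_add_card_filter_not (s := Finset.univ)
    fun j : Fin (2 * h + 2) => (j : ℕ) < h + 2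
  rw [Fin.card_filter_val_lt, Finset.card_univ, Fintype.card_fin] at h1
  simp only [not_lt] at h1
  omega

/-- At every step `h` row sums or `h` column sums exceed `1` by a common amount `d`: the column sums
of the last block after a row normalization, the row sums of the first block after a column
normalization. -/
theorem BlockParams.exists_excess (H : BlockParams h g m β) {V : ℝ}
    (hV : 100 * (β * (h : ℝ) ^ 2 * V ^ 3) ≤ 1) (k : ℕ) (hk : 2 + 2 / h * (k : ℝ) ≤ V) :
    ∃ d, 1 / (2 * (2 + 2 / h * (k : ℝ))) ≤ h * d ∧
      h * d ≤ scalingError 1 (sinkhornKnopp (blockMatrix h g m β) k) ∧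
      √h * d ≤ scalingError 2 (sinkhornKnopp (blockMatrix h g m β) k) := by
  have h2 : (2 : ℝ) ≤ h := by exact_mod_cast H.two_le
  have h0 : 0 < h := by have := H.two_le; omega
  have hw : 0 < 2 / (h : ℝ) := by positivity
  have hdpos : ∀ {v d : ℝ}, 2 ≤ v → 1 / (2 * v) ≤ h * d → 0 ≤ d := by
    intro v d hv hd
    have : 0 < 1 / (2 * v) := by positivity
    exact (pos_of_mul_pos_right (this.trans_le hd) (by positivity)).le
  obtain ⟨t, rfl | rfl⟩ := k.even_or_odd'
  · push_cast at hk ⊢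
    have hv2 : 2 ≤ 2 + 2 / h * (2 * t : ℝ) := by
      have : 0 ≤ 2 / (h : ℝ) * (2 * t) := by positivity
      linarith
    obtain ⟨a, b, c, hy, I⟩ := H.exists_slowInv hV t hk
    have hex := I.excess (H.slowParams hv2 hk hV)
    refine ⟨_, hex, ?_⟩
    have hcol : ∀ j ∈ Finset.univ.filter (fun j : Fin (2 * h + 2) => h + 2 ≤ (j : ℕ)),
        (colSum (sinkhornKnopp (blockMatrix h g m β) (2 * t)) - 1) j =
          (h * β * (bandSum h g β * a + 2 * (h * m) / h * b + h * β * c)⁻¹ +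
            2 * (h * β * a + (1 + β) * b + h * c)⁻¹ +
            bandSum h g β * (h * β * a + 2 * β * b + bandSum h g β * c)⁻¹) * c - 1 := by
      intro j hj
      rw [Finset.mem_filter] at hj
      rw [(sinkhornKnopp_even_odd H.entry_pos t).1, Pi.sub_apply, colSum_scaled,
        H.rowScale_eq hy, hy]
      simp only [blockMatrix, Matrix.of_apply, Pi.one_apply]
      rw [sum_mul_blockEntry h0 H.le]
      have h3 : ¬ (j : ℕ) < h := by omega
      have h4 : ¬ (j : ℕ) < h + 2 := by omega
      simp only [blockVec, h3, h4, if_false]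
      rfl
    obtain ⟨e1, e2⟩ := norm_toLp_bounds (card_filter_ge_block h) (hdpos hv2 hex)
      (fun j hj => (hcol j hj).trans <| by
      have e : 2 * (h : ℝ) / h = 2 := by field_simp
      rw [e]
      ring)
    exact ⟨e1.trans (le_add_of_nonneg_left (norm_nonneg _)),
      e2.trans (le_add_of_nonneg_left (norm_nonneg _))⟩
  · push_cast at hk ⊢
    have hv2 : 2 ≤ 2 + 2 / h * (2 * t : ℝ) := by
      have : 0 ≤ 2 / (h : ℝ) * (2 * t) := by positivity
      linarith
    obtain ⟨a₀, b₀, c₀, hy, I⟩ := H.exists_slowInv hV t (by nlinarith)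
    have ev : 2 + 2 / (h : ℝ) * (2 * t + 1) = 2 + 2 / h * (2 * t) + 2 / h := by ring
    rw [ev] at hk ⊢
    have I' := I.step (H.slowParams hv2 (by linarith) hV)
    have hx := H.rowScale_eq hy
    generalize (h * β * a₀ + 2 * β * b₀ + bandSum h g β * c₀)⁻¹ = c at hx I'
    generalize (h * β * a₀ + (1 + β) * b₀ + h * c₀)⁻¹ = b at hx I'
    generalize (bandSum h g β * a₀ + 2 * (h * m) / h * b₀ + h * β * c₀)⁻¹ = a at hx I'
    have hex := I'.excess (H.slowParams (by linarith) hk hV).symm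
    refine ⟨_, hex, ?_⟩
    have hrow : ∀ i ∈ Finset.univ.filter (fun i : Fin (2 * h + 2) => (i : ℕ) < h),
        (rowSum (sinkhornKnopp (blockMatrix h g m β) (2 * t + 1)) - 1) i =
          a * (bandSum h g β * (h * β * c + 2 * β * b + bandSum h g β * a)⁻¹ +
            2 * m * (h * β * c + (1 + β) * b + h * m * a)⁻¹ +
            h * β * (bandSum h g β * c + 2 * h / h * b + h * β * a)⁻¹) - 1 := by
      intro i hi
      rw [Finset.mem_filter] at hi
      rw [(sinkhornKnopp_even_odd H.entry_pos t).2, Pi.sub_apply, rowSum_scaled,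
        H.colScale_succ_eq hx, hx]
      simp only [blockMatrix, Matrix.of_apply, Pi.one_apply]
      rw [sum_blockEntry_mul h0 H.le]
      simp only [blockVec, hi.2, if_true]
      rfl
    obtain ⟨e1, e2⟩ := norm_toLp_bounds (card_filter_lt_block h) (hdpos (by linarith) hex)
      (fun j hj => (hrow j hj).trans <| by
        have e : 2 * ((h : ℝ) * m) / h = 2 * m := by field_simp
        rw [e])
    exact ⟨e1.trans (le_add_of_nonneg_right (norm_nonneg _)),
      e2.trans (le_add_of_nonneg_right (norm_nonneg _))⟩

end

section

/-! ### The lower bounds for the explicit parameters -/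

theorem exists_gamma {n : ℕ} (hn : 10000 < n) :
    ∃ γ ∈ Set.Ioo (1 / 4 : ℝ) (1 / 2), 2 * ⌈γ * n⌉₊ + 2 ≤ n := by
  refine ⟨1 / 3, ⟨by norm_num, by norm_num⟩, ?_⟩
  have h1 : (10000 : ℝ) < n := by exact_mod_cast hn
  have h2 : (⌈(1 / 3 : ℝ) * n⌉₊ : ℝ) < 1 / 3 * n + 1 := Nat.ceil_lt_add_one (by positivity)
  have h3 : (2 * ⌈(1 / 3 : ℝ) * n⌉₊ + 2 : ℝ) ≤ n := by linarith
  exact_mod_cast h3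

/-- The parameters of `slowMatrix` satisfy the constraints, and `β` is negligible at all levels up
to `1 / (2 * ε)`. -/
theorem blockParams_slowMatrix {h : ℕ} {γ ε : ℝ} (hn : 10000 < 2 * h + 2)
    (hγ : 1 / 4 < γ) (hγn : 2 * ⌈γ * ((2 * h + 2 : ℕ) : ℝ)⌉₊ + 2 ≤ 2 * h + 2)
    (hε : 0 < ε) (hε1 : ε < 1 / 1000) :
    BlockParams h ⌈γ * ((2 * h + 2 : ℕ) : ℝ)⌉₊
      (2 * (⌈γ * ((2 * h + 2 : ℕ) : ℝ)⌉₊ : ℝ) / ((2 * h + 2 : ℕ) : ℝ))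
      (ε ^ 8 / (100 * ((2 * h + 2 : ℕ) : ℝ) ^ 61)) ∧
    100 * (ε ^ 8 / (100 * ((2 * h + 2 : ℕ) : ℝ) ^ 61) * (h : ℝ) ^ 2 * (1 / (2 * ε)) ^ 3) ≤ 1 := by
  set n : ℝ := ((2 * h + 2 : ℕ) : ℝ) with hndef
  have hnh : n = 2 * h + 2 := by rw [hndef]; push_cast; ring
  have hn1 : (10000 : ℝ) < n := by
    have h1 : ((10000 : ℕ) : ℝ) < n := Nat.cast_lt.2 hn
    rwa [Nat.cast_ofNat] at h1
  have hg : γ * n ≤ ⌈γ * n⌉₊ := Nat.le_ceil _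
  have hg' : (2 * ⌈γ * n⌉₊ + 2 : ℝ) ≤ n := by rw [hndef]; exact_mod_cast hγn
  have hg2 : n < 4 * ⌈γ * n⌉₊ := by
    have : 1 / 4 * n < γ * n := mul_lt_mul_of_pos_right hγ (by linarith)
    linarith
  have hpow : (1 : ℝ) ≤ n ^ 61 := one_le_pow₀ (by linarith)
  have hε8 : ε ^ 8 ≤ 1 := pow_le_one₀ hε.le (by linarith)
  refine ⟨⟨by omega, by omega, ?_, ?_, ?_, by positivity, ?_⟩, ?_⟩
  · have : (h : ℝ) ≤ 2 * ⌈γ * n⌉₊ := by linarith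
    exact_mod_cast this
  · rw [div_le_div_iff₀ (by norm_num) (by linarith)]; linarith
  · rw [div_le_one (by linarith)]; linarith
  · rw [div_lt_iff₀ (by positivity)]; linarith
  · have e : 100 * (ε ^ 8 / (100 * n ^ 61) * (h : ℝ) ^ 2 * (1 / (2 * ε)) ^ 3) =
        ε ^ 5 * (h : ℝ) ^ 2 / (8 * n ^ 61) := by
      have : n ≠ 0 := by linarith
      field_simp
      norm_num
    rw [e, div_le_one (by positivity)]
    have h1 : ε ^ 5 ≤ 1 := pow_le_one₀ hε.le (by linarith)
    have h2 : (h : ℝ) ^ 2 ≤ n ^ 2 := by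
      have : (h : ℝ) ≤ n := by linarith [(Nat.cast_nonneg h : (0 : ℝ) ≤ h)]
      gcongr
    have h3 : n ^ 2 ≤ n ^ 61 := pow_le_pow_right₀ (by linarith) (by norm_num)
    calc ε ^ 5 * (h : ℝ) ^ 2 ≤ 1 * n ^ 61 := by
          apply mul_le_mul h1 (h2.trans h3) (by positivity) (by norm_num)
      _ ≤ 8 * n ^ 61 := by linarith

/-- For `k ≤ n / (100 δ)` the level `2 + 2 k / h` is still below `1 / (2 δ)`. -/
theorem level_lt {h k : ℕ} {δ : ℝ} (hh : 2 ≤ h) (hδ : 0 < δ) (hδ1 : δ ≤ 1 / 1000)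
    (hk : (k : ℝ) ≤ 1 / 100 * (((2 * h + 2 : ℕ) : ℝ) / δ)) :
    2 + 2 / (h : ℝ) * k < 1 / (2 * δ) := by
  have hh' : (2 : ℝ) ≤ h := by exact_mod_cast hh
  have h1 : 2 / (h : ℝ) * k ≤ 6 / (100 * δ) := by
    calc 2 / (h : ℝ) * k ≤ 2 / (h : ℝ) * (1 / 100 * (((2 * h + 2 : ℕ) : ℝ) / δ)) := by gcongr
      _ ≤ 2 / (h : ℝ) * (1 / 100 * (3 * h / δ)) := by
        gcongr
        push_cast
        linarith
      _ = _ := by field_simp; norm_num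
  have h2 : 2 ≤ 1 / (500 * δ) := by
    rw [le_div_iff₀ (by positivity)]; linarith
  have h3 : 1 / (500 * δ) + 6 / (100 * δ) < 1 / (2 * δ) := by
    have e : 1 / (2 * δ) - (1 / (500 * δ) + 6 / (100 * δ)) = 438 / (1000 * δ) := by
      field_simp; norm_num
    have : 0 < 438 / (1000 * δ) := by positivity
    linarith
  linarith

/-- An excess of `h * d` at a level below `1 / (2 δ)` exceeds `δ`. -/
theorem lt_of_level_lt {v δ x : ℝ} (hv : 2 ≤ v) (hδ : 0 < δ) (hvδ : v < 1 / (2 * δ))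
    (hx : 1 / (2 * v) ≤ x) : δ < x := by
  refine lt_of_lt_of_le ?_ hx
  rw [lt_div_iff₀ (by positivity)] at hvδ ⊢
  linarith

end

end

end SinkhornLB

theorem theorem1p3 :
    ∃ c : ℝ, 0 < c ∧ ∃ ρ : ℝ, 0 < ρ ∧ ρ ≤ 1 ∧
      ∀ n : ℕ, Even n → 10000 < n →
        (∃ γ ∈ Set.Ioo (1 / 4 : ℝ) (1 / 2), 2 * ⌈γ * n⌉₊ + 2 ≤ n) ∧
        ∀ γ ∈ Set.Ioo (1 / 4 : ℝ) (1 / 2), 2 * ⌈γ * n⌉₊ + 2 ≤ n →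
          ∀ ε : ℝ, 0 < ε → ε < 1 / 1000 →
            (∀ i j, 0 < SinkhornLB.slowMatrix n γ ε i j) ∧
            (∀ i j, SinkhornLB.slowMatrix n γ ε i j ∈
              Set.Icc (ε ^ 8 / (100 * (n : ℝ) ^ 61)) 1) ∧
            SinkhornLB.IsDenseMatrix γ ρ (SinkhornLB.slowMatrix n γ ε) ∧
            SinkhornLB.IsScalable (SinkhornLB.slowMatrix n γ ε) 1 1 ∧
            SinkhornLB.SinkhornKnoppConverges (SinkhornLB.slowMatrix n γ ε) ∧
            (∀ k : ℕ, (k : ℝ) ≤ c * (n / ε) →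
              ε < SinkhornLB.scalingError 1
                (SinkhornLB.sinkhornKnopp (SinkhornLB.slowMatrix n γ ε) k)) ∧
            (ε ≤ 1 / (1000 * √(n : ℝ)) →
              ∀ k : ℕ, (k : ℝ) ≤ c * (√(n : ℝ) / ε) →
                ε < SinkhornLB.scalingError 2
                  (SinkhornLB.sinkhornKnopp (SinkhornLB.slowMatrix n γ ε) k)) := by
  refine ⟨1 / 100, by norm_num, 1 / 2, by norm_num, by norm_num, ?_⟩
  intro n hn_even hn
  refine ⟨SinkhornLB.exists_gamma hn, ?_⟩
  obtain ⟨h, rfl⟩ : ∃ h, n = 2 * h + 2 := by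
    obtain ⟨r, hr⟩ := hn_even
    exact ⟨r - 1, by omega⟩
  intro γ hγ hγn ε hε hε1
  obtain ⟨P, hV⟩ := SinkhornLB.blockParams_slowMatrix hn hγ.1 hγn hε hε1
  have hA := SinkhornLB.slowMatrix_eq_blockMatrix h γ ε
  obtain ⟨hscal, hconv⟩ := SinkhornLB.isScalable_and_converges P.pos P.mem_Icc
  have hlevel : ∀ k : ℕ, 2 ≤ 2 + 2 / (h : ℝ) * k := fun k => by
    have : 0 ≤ 2 / (h : ℝ) * k := by positivity
    linarith
  rw [hA]
  refine ⟨P.entry_pos, P.mem_Icc, P.isDenseMatrix rfl, hscal, hconv, ?_, ?_⟩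
  · intro k hk
    have hlt := SinkhornLB.level_lt P.two_le hε hε1.le hk
    obtain ⟨d, hd, h1, -⟩ := P.exists_excess hV k hlt.le
    exact (SinkhornLB.lt_of_level_lt (hlevel k) hε hlt hd).trans_le h1
  · intro hεn k hk
    have hn0 : (0 : ℝ) < ((2 * h + 2 : ℕ) : ℝ) := by positivity
    set n : ℝ := ((2 * h + 2 : ℕ) : ℝ) with hndef
    have hs : 0 < √n := Real.sqrt_pos.2 hn0
    have hs1 : 1 ≤ √n := by
      rw [Real.one_le_sqrt, hndef]; push_cast; linarith [(Nat.cast_nonneg h : (0 : ℝ) ≤ h)]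
    -- the `ℓ₂` bound is the `ℓ₁` argument run down to the total excess `√n * ε`
    have hδ : 0 < √n * ε := by positivity
    have hδ1 : √n * ε ≤ 1 / 1000 := by
      rw [le_div_iff₀ (by positivity)] at hεn
      linarith
    have hk' : (k : ℝ) ≤ 1 / 100 * (n / (√n * ε)) := by
      have e : n / (√n * ε) = √n / ε := by
        rw [div_mul_eq_div_div, Real.div_sqrt]
      rwa [e]
    have hlt := SinkhornLB.level_lt P.two_le hδ hδ1 hk'
    have hle : 1 / (2 * (√n * ε)) ≤ 1 / (2 * ε) := by
      have : ε ≤ √n * ε := le_mul_of_one_le_left hε.le hs1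
      gcongr
    obtain ⟨d, hd, -, h2⟩ := P.exists_excess hV k (hlt.le.trans hle)
    refine lt_of_lt_of_le ?_ h2
    have h3 : √n * ε < h * d := SinkhornLB.lt_of_level_lt (hlevel k) hδ hlt hd
    have hsh : √(h : ℝ) ≤ √n := Real.sqrt_le_sqrt (by rw [hndef]; push_cast; linarith)
    have hsh0 : 0 < √(h : ℝ) := Real.sqrt_pos.2 (by
      have := P.two_le
      positivity)
    have h4 : √(h : ℝ) * ε < √(h : ℝ) * (√(h : ℝ) * d) := by
      rw [← mul_assoc, Real.mul_self_sqrt (Nat.cast_nonneg h)]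
      exact lt_of_le_of_lt (by gcongr) h3
    exact lt_of_mul_lt_mul_left h4 hsh0.le
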